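/- Let $K$ be a field of characteristic $0$ containing all roots of unity (that is, containing a primitive $n$-th root of unity for every $n\ge 1$). All algebras are finite-dimensional associative $K$-algebras with identity. For a finite quiver $Q$ let $KQ$ be its path algebra and $J$ the two-sided ideal generated by the arrows; a two-sided ideal $I$ of $KQ$ is admissible if $J^N\subseteq I\subseteq J^2$ for some $N\ge 2$. An algebra $A$ with Jacobson radical $R$ is called - *monomial* if $A\cong KQ/I$ as $K$-algebras for some finite quiver $Q$ and some admissible ideal $I$ of $KQ$ generated by a set of paths; - *elementary* if $A/R\cong K^n$ as $K$-algebras for some $n$; - *Frobenius* if $A\cong A^*=\operatorname{Hom}_K(A,K)$ as left $A$-modules; - *Nakayama* if each indecomposable projective left $A$-module and each indecomposable projective right $A$-module has a unique composition series. (1) An algebra $A$ is monomial and Frobenius if and only if it is elementary, Nakayama and Frobenius. (2) A finite-dimensional Hopf algebra $H$ over $K$ is monomial (that is, its underlying algebra is monomial) if and only if its underlying algebra is elementary and Nakayama. -/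

import Mathlib

universe u v w

/-- A path in a quiver `V`, bundled with its starting vertex and its ending vertex.
(The trivial path at each vertex is included.) -/
structure QuiverPath (V : Type*) [Quiver V] where
  /-- starting vertex -/
  src : V
  /-- ending vertex -/
  tgt : V
  /-- the path itself -/
  path : Quiver.Path src tgt

/-- The path algebra `KQ` of a quiver `Q` with vertex set `V`: as a vector space it has
the set of all paths as a basis. The product is defined below. -/
def PathAlgebra (K : Type*) (V : Type*) [Quiver V] [CommRing K] : Type _ :=
  QuiverPath V →₀ K

namespace PathAlgebra

variable (K : Type*) [CommRing K] (V : Type*) [Quiver V]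

noncomputable instance : AddCommGroup (PathAlgebra K V) :=
  inferInstanceAs (AddCommGroup (QuiverPath V →₀ K))

noncomputable instance : Module K (PathAlgebra K V) :=
  inferInstanceAs (Module K (QuiverPath V →₀ K))

variable {V}

/-- The basis element of the path algebra given by a path. -/
noncomputable def ofPath (p : QuiverPath V) : PathAlgebra K V :=
  Finsupp.single p (1 : K)

/-- The trivial path `e_v` at a vertex `v`. -/
def idPath (v : V) : QuiverPath V := ⟨v, v, Quiver.Path.nil⟩

/-- The path of length one given by an arrow. -/
def arrowPath {a b : V} (f : a ⟶ b) : QuiverPath V := ⟨a, b, f.toPath⟩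

open Classical in
/-- The product `q p` of two paths (first `p`, then `q`): their concatenation if `p` ends where `q`
starts, and `0` otherwise. -/
noncomputable def pathMul (q p : QuiverPath V) : PathAlgebra K V :=
  if h : p.tgt = q.src then
    ofPath K ⟨p.src, q.tgt, (p.path.cast rfl h).comp q.path⟩
  else 0

variable (V)

/-- The bilinear extension of `pathMul`. -/
noncomputable def mulHom : PathAlgebra K V →ₗ[K] PathAlgebra K V →ₗ[K] PathAlgebra K V :=
  Finsupp.linearCombination K fun q : QuiverPath V =>
    (Finsupp.linearCombination K fun p : QuiverPath V => pathMul K q p :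
      (QuiverPath V →₀ K) →ₗ[K] PathAlgebra K V)

variable {V}

noncomputable instance : Mul (PathAlgebra K V) := ⟨fun x y => mulHom K V x y⟩

noncomputable instance [Fintype V] : One (PathAlgebra K V) := ⟨∑ v : V, ofPath K (idPath v)⟩

theorem mul_def (x y : PathAlgebra K V) : x * y = mulHom K V x y := rfl

theorem one_def [Fintype V] : (1 : PathAlgebra K V) = ∑ v : V, ofPath K (idPath v) := rfl

theorem ofPath_mul_ofPath (q p : QuiverPath V) : ofPath K q * ofPath K p = pathMul K q p := by
  rw [mul_def]
  unfold mulHom ofPath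
  erw [Finsupp.linearCombination_single, one_smul, Finsupp.linearCombination_single, one_smul]

theorem ofPath_mul_of_eq {a b c : V} (p : Quiver.Path a b) (q : Quiver.Path b c) :
    ofPath K ⟨b, c, q⟩ * ofPath K ⟨a, b, p⟩ = ofPath K ⟨a, c, p.comp q⟩ := by
  rw [ofPath_mul_ofPath]
  simp [pathMul]

theorem ofPath_mul_of_ne {q p : QuiverPath V} (h : p.tgt ≠ q.src) :
    ofPath K q * ofPath K p = 0 := by
  rw [ofPath_mul_ofPath]
  simp [pathMul, h]

theorem induction {P : PathAlgebra K V → Prop} (x : PathAlgebra K V) (h0 : P 0)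
    (hadd : ∀ x y, P x → P y → P (x + y)) (hs : ∀ (c : K) p, P (c • ofPath K p)) : P x := by
  refine Finsupp.induction_linear (motive := P) x h0 hadd fun p c => ?_
  have := hs c p
  unfold ofPath at this
  erw [Finsupp.smul_single, smul_eq_mul, mul_one] at this
  exact this

theorem add_mul' (x y z : PathAlgebra K V) : (x + y) * z = x * z + y * z := by
  simp [mul_def]

theorem mul_add' (x y z : PathAlgebra K V) : x * (y + z) = x * y + x * z := by
  simp [mul_def]

theorem zero_mul' (x : PathAlgebra K V) : 0 * x = 0 := by simp [mul_def]

theorem mul_zero' (x : PathAlgebra K V) : x * 0 = 0 := by simp [mul_def]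

theorem smul_mul' (c : K) (x y : PathAlgebra K V) : (c • x) * y = c • (x * y) := by
  simp [mul_def]

theorem mul_smul' (c : K) (x y : PathAlgebra K V) : x * (c • y) = c • (x * y) := by
  simp [mul_def]

theorem ofPath_mul_assoc (r q p : QuiverPath V) :
    ofPath K r * ofPath K q * ofPath K p = ofPath K r * (ofPath K q * ofPath K p) := by
  obtain ⟨r1, r2, r⟩ := r
  obtain ⟨q1, q2, q⟩ := q
  obtain ⟨p1, p2, p⟩ := p
  by_cases h : q2 = r1
  · subst h
    rw [ofPath_mul_of_eq]
    by_cases h' : p2 = q1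
    · subst h'
      simp only [ofPath_mul_of_eq, Quiver.Path.comp_assoc]
    · rw [ofPath_mul_of_ne K (by exact h'), ofPath_mul_of_ne K (by exact h'), mul_zero']
  · rw [ofPath_mul_of_ne K (by exact h), zero_mul']
    by_cases h' : p2 = q1
    · subst h'
      rw [ofPath_mul_of_eq, ofPath_mul_of_ne K (by exact h)]
    · rw [ofPath_mul_of_ne K (by exact h'), mul_zero']

theorem mul_assoc' (x y z : PathAlgebra K V) : x * y * z = x * (y * z) := by
  induction x using PathAlgebra.induction with
  | h0 => simp only [zero_mul']
  | hadd x x' hx hx' => simp only [add_mul', hx, hx']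
  | hs c r =>
    induction y using PathAlgebra.induction with
    | h0 => simp only [zero_mul', mul_zero']
    | hadd y y' hy hy' => simp only [add_mul', mul_add', hy, hy']
    | hs d q =>
      induction z using PathAlgebra.induction with
      | h0 => simp only [mul_zero']
      | hadd z z' hz hz' => simp only [mul_add', hz, hz']
      | hs e p => simp only [smul_mul', mul_smul', ofPath_mul_assoc]

theorem one_mul' [Fintype V] (x : PathAlgebra K V) : 1 * x = x := by
  induction x using PathAlgebra.induction with
  | h0 => simp only [mul_zero']
  | hadd x x' hx hx' => simp only [mul_add', hx, hx']
  | hs c p =>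
    rw [mul_smul', one_def, mul_def, map_sum, LinearMap.sum_apply]
    congr 1
    obtain ⟨a, b, p⟩ := p
    rw [Finset.sum_eq_single b]
    · rw [← mul_def, idPath, ofPath_mul_of_eq, Quiver.Path.comp_nil]
    · intro v _ hv
      rw [← mul_def, ofPath_mul_of_ne K (by exact hv.symm)]
    · simp

theorem mul_one' [Fintype V] (x : PathAlgebra K V) : x * 1 = x := by
  induction x using PathAlgebra.induction with
  | h0 => simp only [zero_mul']
  | hadd x x' hx hx' => simp only [add_mul', hx, hx']
  | hs c p =>
    rw [smul_mul', one_def, mul_def, map_sum]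
    congr 1
    obtain ⟨a, b, p⟩ := p
    rw [Finset.sum_eq_single a]
    · rw [← mul_def, idPath, ofPath_mul_of_eq, Quiver.Path.nil_comp]
    · intro v _ hv
      rw [← mul_def, ofPath_mul_of_ne K (by exact hv)]
    · simp

noncomputable instance [Fintype V] : Ring (PathAlgebra K V) :=
  { (inferInstance : AddCommGroup (PathAlgebra K V)),
    (inferInstance : Mul (PathAlgebra K V)),
    (inferInstance : One (PathAlgebra K V)) with
    left_distrib := mul_add' K
    right_distrib := add_mul' K
    zero_mul := zero_mul' K
    mul_zero := mul_zero' K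
    mul_assoc := mul_assoc' K
    one_mul := one_mul' K
    mul_one := mul_one' K }

noncomputable instance [Fintype V] : Algebra K (PathAlgebra K V) :=
  Algebra.ofModule (smul_mul' K) (mul_smul' K)

/-- The two-sided ideal of the path algebra generated by a set of paths. -/
noncomputable def pathIdeal [Fintype V] (S : Set (QuiverPath V)) :
    TwoSidedIdeal (PathAlgebra K V) :=
  TwoSidedIdeal.span (ofPath K '' S)

variable (V) in
/-- The two-sided ideal `J` generated by the arrows. -/
noncomputable def arrowIdeal [Fintype V] : TwoSidedIdeal (PathAlgebra K V) :=
  pathIdeal K {p | ∃ (a b : V) (f : a ⟶ b), p = arrowPath f}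

/-- A two-sided ideal `I` of the path algebra is admissible if `J ^ N ⊆ I ⊆ J ^ 2` for some
`N ≥ 2`. -/
def IsAdmissible [Fintype V] (I : TwoSidedIdeal (PathAlgebra K V)) : Prop :=
  ∃ N : ℕ, 2 ≤ N ∧ (arrowIdeal K V).asIdeal ^ N ≤ I.asIdeal ∧
    I.asIdeal ≤ (arrowIdeal K V).asIdeal ^ 2

end PathAlgebra

/-- A `K`-algebra `A` is monomial if `A ≅ KQ/I` as `K`-algebras for some finite quiver `Q` and some
admissible ideal `I` of `KQ` generated by a set of paths. -/
def IsMonomialAlgebra (K A : Type*) [Field K] [Ring A] [Algebra K A] : Prop :=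
  ∃ (V : Type) (_ : Fintype V) (_ : Quiver.{0} V) (_ : ∀ a b : V, Finite (a ⟶ b))
    (S : Set (QuiverPath V)),
    PathAlgebra.IsAdmissible K (PathAlgebra.pathIdeal K S) ∧
    Nonempty (A ≃ₐ[K] PathAlgebra K V ⧸ (PathAlgebra.pathIdeal K S).asIdeal)

/-- A `K`-algebra `A` is elementary if `A / rad A ≅ K ^ n` as `K`-algebras for some `n`. -/
def IsElementaryAlgebra (K A : Type*) [Field K] [Ring A] [Algebra K A] : Prop :=
  ∃ n : ℕ, Nonempty ((A ⧸ Ring.jacobson A) ≃ₐ[K] (Fin n → K))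

/-- A `K`-algebra `A` is Frobenius if `A ≅ A^*` as left `A`-modules, where `A^* = Hom_K(A, K)` has
the left `A`-module structure `(a • f) x = f (x * a)`. (Any `A`-linear map is `K`-linear.) -/
def IsFrobeniusAlgebra (K A : Type*) [Field K] [Ring A] [Algebra K A] : Prop :=
  ∃ φ : A ≃ₗ[K] Module.Dual K A, ∀ a b x : A, φ (a * b) x = φ b (x * a)

/-- A module is indecomposable if it is nonzero and not a direct sum of two nonzero submodules. -/
def IsIndecomposableModule (R M : Type*) [Ring R] [AddCommGroup M] [Module R M] : Prop :=
  Nontrivial M ∧ ∀ N N' : Submodule R M, IsCompl N N' → N = ⊥ ∨ N' = ⊥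

/-- A module has a unique composition series (from the zero submodule to the whole module). -/
def HasUniqueCompositionSeries (R M : Type*) [Ring R] [AddCommGroup M] [Module R M] : Prop :=
  ∃! s : CompositionSeries (Submodule R M), s.head = ⊥ ∧ s.last = ⊤

/-- A ring `A` is Nakayama if each indecomposable projective left module and each
indecomposable projective right module (a module over `Aᵐᵒᵖ`) has a unique composition series. -/
def IsNakayamaAlgebra (A : Type u) [Ring A] : Prop :=
  (∀ (P : Type u) [AddCommGroup P] [Module A P], Module.Projective A P →
    IsIndecomposableModule A P → HasUniqueCompositionSeries A P) ∧
  (∀ (P : Type u) [AddCommGroup P] [Module Aᵐᵒᵖ P], Module.Projective Aᵐᵒᵖ P →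
    IsIndecomposableModule Aᵐᵒᵖ P → HasUniqueCompositionSeries Aᵐᵒᵖ P)

/-! Both sides are compared through paths.

If `A` is monomial, its nonzero paths form a basis in which a product of two basis elements is zero
or again a basis element (`PathBasis`). Let `f` be the nondegenerate form of a Frobenius structure.
Radical elements kill from the left the span of the maximal paths, so on that span the map sending
`x` to the family of scalars `f (e_v * x)` is injective. There are therefore at most as many maximal
paths as vertices, and exactly one starts at each vertex (`src_injOn_maximal`). Two paths of equal
length with the same source are then initial segments of the same maximal path, hence equal
(`serial_of_functional`). The submodules of `A e_v` are generated by the successive paths out of `v`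
and form a chain. Every indecomposable projective is some `A e_v`, and the opposite algebra takes
care of right modules.

Conversely, let `A` be elementary and Nakayama, with radical `R`. Lift the idempotents of `A / R` to
`e_i`. Uniseriality gives a single generator `x_i = e_j x_i e_i` of each `R e_i`. This defines a
quiver with at most one arrow out of each vertex and a surjection from its path algebra onto `A`. Of
two paths with the same source one extends the other, so in a relation each later term is a radical
multiple of the shortest one and cannot cancel it. Hence the kernel is spanned by paths
(`mem_pathSpan_of_toAlgHom_eq_zero`).

For Hopf algebras it remains to see that monomial implies Frobenius. A maximal path spans a
one-dimensional left ideal; twisting by its character turns it into a nonzero left integral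
(`exists_isLeftIntegral`), and such an integral forces the antipode to be bijective and the algebra
to be Frobenius. -/

/-! ### Unique composition series and chains of submodules. -/

section Uniserial

variable {R M : Type*} [Ring R] [AddCommGroup M] [Module R M]

/-- Climb the series: if `N` is missing, it cannot sit between two consecutive terms, since these
cover each other, so every term is below `N`, including the top one. -/
theorem CompositionSeries.mem_of_total {s : CompositionSeries (Submodule R M)}
    (h0 : s.head = ⊥) (h1 : s.last = ⊤)
    (h : ∀ N N' : Submodule R M, N ≤ N' ∨ N' ≤ N) (N : Submodule R M) : N ∈ s := by
  by_contra hN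
  have key : ∀ i : ℕ, ∀ hi : i < s.length + 1, s ⟨i, hi⟩ ≤ N := by
    intro i
    induction i with
    | zero =>
      intro hi
      have : s ⟨0, hi⟩ = ⊥ := h0
      rw [this]; exact bot_le
    | succ i ih =>
      intro hi
      have hi' : i < s.length := by omega
      have h2 := ih (by omega)
      rcases h (s ⟨i + 1, hi⟩) N with h3 | h3
      · exact h3
      · have hc : s ⟨i, by omega⟩ ⋖ s ⟨i + 1, hi⟩ := s.step ⟨i, hi'⟩
        rcases hc.eq_or_eq h2 h3 with h4 | h4
        · exact (hN ⟨_, h4.symm⟩).elim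
        · exact (hN ⟨_, h4.symm⟩).elim
  have := key s.length (by omega)
  have h2 : s ⟨s.length, by omega⟩ = ⊤ := h1
  rw [h2, top_le_iff] at this
  exact hN ⟨_, h2.trans this.symm⟩

theorem hasUniqueCompositionSeries_of_total [IsNoetherian R M] [IsArtinian R M]
    (h : ∀ N N' : Submodule R M, N ≤ N' ∨ N' ≤ N) : HasUniqueCompositionSeries R M := by
  obtain ⟨s, h0, h1⟩ := exists_compositionSeries_of_isNoetherian_isArtinian R M
  refine ⟨s, ⟨h0, h1⟩, fun t ht => CompositionSeries.ext fun x => ?_⟩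
  simp [CompositionSeries.mem_of_total h0 h1 h, CompositionSeries.mem_of_total ht.1 ht.2 h]

/-- Any single submodule can be refined to a composition series, so by uniqueness the one series
contains all submodules. -/
theorem HasUniqueCompositionSeries.total [IsNoetherian R M] [IsArtinian R M]
    (h : HasUniqueCompositionSeries R M) (N N' : Submodule R M) : N ≤ N' ∨ N' ≤ N := by
  obtain ⟨s, -, hs⟩ := h
  have key (N : Submodule R M) : N ∈ s := by
    obtain ⟨t, i, hi, h0, h1⟩ :=
      LTSeries.exists_relSeries_covBy_and_head_eq_bot_and_last_eq_bot
        (RelSeries.singleton {(a, b) : Submodule R M × Submodule R M | a < b} N)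
    rw [← hs t ⟨h0, h1⟩]
    exact ⟨i 0, congr_fun hi 0⟩
  exact CompositionSeries.total (key N) (key N')

theorem LinearEquiv.total_submodule {M' : Type*} [AddCommGroup M'] [Module R M'] (f : M ≃ₗ[R] M')
    (h : ∀ N N' : Submodule R M, N ≤ N' ∨ N' ≤ N) (N N' : Submodule R M') : N ≤ N' ∨ N' ≤ N := by
  have := h ((Submodule.orderIsoMapComap f).symm N) ((Submodule.orderIsoMapComap f).symm N')
  rwa [OrderIso.le_iff_le, OrderIso.le_iff_le] at this

/-- Submodules of `R y₀` form a chain, if `R y₀ ⊇ R y₁ ⊇ ⋯` reaches zero and each multiple of `y k`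
that is not a multiple of `y (k + 1)` generates `y k`. -/
theorem total_of_generators (y : ℕ → M) {n : ℕ} (hn : y n = 0)
    (hy : ∀ k, y (k + 1) ∈ Submodule.span R {y k})
    (h : ∀ k (b : R), b • y k ∈ Submodule.span R {y (k + 1)} ∨
      y k ∈ Submodule.span R {b • y k})
    {N N' : Submodule R M} (hN : N ≤ Submodule.span R {y 0})
    (hN' : N' ≤ Submodule.span R {y 0}) : N ≤ N' ∨ N' ≤ N := by
  classical
  have key (N : Submodule R M) (hN : N ≤ Submodule.span R {y 0}) :
      ∃ k, N = Submodule.span R {y k} := by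
    have hex : ∃ k, y k ∈ N := ⟨n, hn ▸ N.zero_mem⟩
    -- `N` is generated by the first `y k` it contains: an element of `N` lying in `R y i` but not
    -- in `R y (i + 1)` would put the earlier `y i` into `N`.
    refine ⟨Nat.find hex, le_antisymm ?_ ?_⟩
    · have : ∀ i, i ≤ Nat.find hex → N ≤ Submodule.span R {y i} := by
        intro i
        induction i with
        | zero => exact fun _ => hN
        | succ i ih =>
          intro hi x hx
          obtain ⟨b, rfl⟩ := Submodule.mem_span_singleton.mp (ih (by omega) hx)
          rcases h i b with h1 | h1
          · exact h1
          · refine absurd ?_ (Nat.find_min hex (m := i) (by omega))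
            exact (Submodule.span_singleton_le_iff_mem _ _).mpr hx h1
      exact this _ le_rfl
    · exact (Submodule.span_singleton_le_iff_mem _ _).mpr (Nat.find_spec hex)
  have anti : Antitone fun k => Submodule.span R {y k} :=
    antitone_nat_of_succ_le fun k => (Submodule.span_singleton_le_iff_mem _ _).mpr (hy k)
  obtain ⟨k, rfl⟩ := key N hN
  obtain ⟨k', rfl⟩ := key N' hN'
  rcases le_total k k' with h1 | h1
  · exact Or.inr (anti h1)
  · exact Or.inl (anti h1)

theorem Submodule.total_of_le (Q : Submodule R M)
    (h : ∀ N N' : Submodule R M, N ≤ Q → N' ≤ Q → N ≤ N' ∨ N' ≤ N) (N N' : Submodule R Q) :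
    N ≤ N' ∨ N' ≤ N := by
  have := h _ _ (Submodule.map_subtype_le Q N) (Submodule.map_subtype_le Q N')
  simpa [Submodule.map_le_map_iff_of_injective Q.injective_subtype] using this

end Uniserial

/-! ### Indecomposable projective modules. -/

section Projective

variable {R : Type*} [Ring R]

theorem LinearMap.isCompl_range_ker {P Q : Type*} [AddCommGroup P] [Module R P] [AddCommGroup Q]
    [Module R Q] {g : P →ₗ[R] Q} {s : Q →ₗ[R] P} (h : g ∘ₗ s = LinearMap.id) :
    IsCompl (LinearMap.range s) (LinearMap.ker g) := by
  have h' (y : Q) : g (s y) = y := LinearMap.congr_fun h y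
  refine ⟨Submodule.disjoint_def.mpr ?_, codisjoint_iff.mpr (eq_top_iff.mpr fun x _ => ?_)⟩
  · rintro _ ⟨y, rfl⟩ hx
    rw [LinearMap.mem_ker, h'] at hx
    rw [hx, map_zero]
  · rw [← add_sub_cancel (s (g x)) x]
    exact Submodule.add_mem_sup ⟨_, rfl⟩ (by simp [h'])

/-- Nakayama's lemma for a nilpotent ideal: `P = J P` iterates to `P = J ^ m P = 0`, with no
finiteness condition on `P`. -/
theorem Submodule.eq_zero_of_isNilpotent_smul {P : Type*} [AddCommGroup P] [Module R P]
    {J : Ideal R} {m : ℕ} (hJ : J ^ m = ⊥) (h : ∀ x : P, x ∈ J • (⊤ : Submodule R P)) (x : P) :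
    x = 0 := by
  have h1 : J • (⊤ : Submodule R P) = ⊤ := eq_top_iff.mpr fun x _ => h x
  have h2 : ∀ k, (J ^ k) • (⊤ : Submodule R P) = ⊤ := by
    intro k
    induction k with
    | zero =>
      rw [Submodule.pow_zero, Submodule.one_eq_span]
      refine eq_top_iff.mpr fun x _ => ?_
      rw [← one_smul R x]
      exact Submodule.smul_mem_smul (Submodule.mem_span_singleton_self 1) Submodule.mem_top
    | succ k ih => rw [Submodule.pow_succ, ← smul_eq_mul, Submodule.smul_assoc, h1, ih]
  have := h2 m
  rw [hJ, Submodule.bot_smul] at this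
  have hx : x ∈ (⊥ : Submodule R P) := this ▸ Submodule.mem_top
  simpa using hx

/-- The left ideal generated by an idempotent is projective. -/
theorem IsIdempotentElem.projective_span {e : R} (he : IsIdempotentElem e) :
    Module.Projective R (Submodule.span R {e}) := by
  refine Module.Projective.of_split (M := R) (Submodule.span R {e}).subtype
    (LinearMap.toSpanSingleton R _ ⟨e, Submodule.mem_span_singleton_self e⟩) ?_
  ext ⟨x, hx⟩
  obtain ⟨b, rfl⟩ := Submodule.mem_span_singleton.mp hx
  simp [mul_assoc, he.eq]

/-- If `1` is a sum of idempotents `e v` with `R e_v` local, then each indecomposable projective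
module is isomorphic to some `R e_v`. -/
theorem IsIndecomposableModule.exists_equiv_span {V : Type*} [Fintype V] {e : V → R}
    (he : ∀ v, IsIdempotentElem (e v)) (hsum : ∑ v, e v = 1) (hne : ∀ v, e v ≠ 0)
    {J : Ideal R} {m : ℕ} (hJ : J ^ m = ⊥)
    (hloc : ∀ v, ∀ x ∈ Submodule.span R {e v}, x ∈ J ∨ e v ∈ Submodule.span R {x})
    {P : Type*} [AddCommGroup P] [Module R P] [hP : Module.Projective R P]
    (hi : IsIndecomposableModule R P) :
    ∃ v, Nonempty (P ≃ₗ[R] Submodule.span R {e v}) := by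
  -- A surjection of `P` onto some `R e_v` splits, and indecomposability makes it an isomorphism.
  -- Without one, `P = J P`, which forces `P = 0`.
  by_cases hsurj : ∃ v, ∃ g : P →ₗ[R] Submodule.span R {e v}, Function.Surjective g
  · obtain ⟨v, g, hg⟩ := hsurj
    have := (he v).projective_span
    obtain ⟨s, hs⟩ := g.exists_rightInverse_of_surjective (LinearMap.range_eq_top.mpr hg)
    have hc : IsCompl (LinearMap.range s) (LinearMap.ker g) :=
      LinearMap.isCompl_range_ker hs
    refine ⟨v, ⟨LinearEquiv.ofBijective g ⟨?_, hg⟩⟩⟩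
    rw [← LinearMap.ker_eq_bot]
    rcases hi.2 _ _ hc with h | h
    · exfalso
      have h1 : s = 0 := LinearMap.range_eq_bot.mp h
      have h2 := LinearMap.congr_fun hs ⟨e v, Submodule.mem_span_singleton_self _⟩
      simp only [h1, LinearMap.comp_zero, LinearMap.zero_apply, LinearMap.id_apply] at h2
      exact hne v (congrArg Subtype.val h2).symm
    · exact h
  · exfalso
    push Not at hsurj
    -- If a component `f p * e v` were outside `J`, it would generate `R e_v`, and `f` followed by
    -- right multiplication by `e v` would be onto.
    have hJf (f : P →ₗ[R] R) (p : P) : f p ∈ J := by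
      rw [← mul_one (f p), ← hsum, Finset.mul_sum]
      refine J.sum_mem fun v _ => ?_
      have hm : f p * e v ∈ Submodule.span R {e v} := Submodule.mem_span_singleton.mpr ⟨_, rfl⟩
      refine (hloc v _ hm).resolve_right fun hev => hsurj v
        ((LinearMap.toSpanSingleton R _ ⟨e v, Submodule.mem_span_singleton_self _⟩) ∘ₗ f) ?_
      rintro ⟨x, hx⟩
      obtain ⟨b, rfl⟩ := Submodule.mem_span_singleton.mp hx
      obtain ⟨c, hc⟩ := Submodule.mem_span_singleton.mp hev
      refine ⟨(b * c) • p, Subtype.ext ?_⟩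
      simp only [LinearMap.comp_apply, map_smul, LinearMap.toSpanSingleton_apply,
        Submodule.coe_smul, smul_eq_mul]
      rw [smul_eq_mul] at hc
      rw [mul_assoc, hc]
    -- Dual basis argument: the section `s` writes each `p` as a combination whose coefficients are
    -- values of functionals, hence lie in `J`.
    obtain ⟨s, hs⟩ := Module.projective_def'.mp hP
    obtain ⟨x, hx⟩ := @exists_ne P hi.1 0
    refine hx (Submodule.eq_zero_of_isNilpotent_smul hJ (fun p => ?_) x)
    have h1 := LinearMap.congr_fun hs p
    rw [LinearMap.comp_apply, Finsupp.linearCombination_apply, LinearMap.id_apply] at h1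
    rw [← h1]
    exact Submodule.sum_mem _ fun q _ =>
      Submodule.smul_mem_smul (hJf (Finsupp.lapply q ∘ₗ s) p) Submodule.mem_top

end Projective

/-! ### Algebras with a basis of paths, and the effect of a nondegenerate form. -/

/-- A basis of an algebra that behaves like the set of nonzero paths of a bound quiver with
monomial relations: a product of basis elements is zero or again a basis element. -/
structure PathBasis (K A V ι : Type*) [Field K] [Ring A] [Algebra K A] [Fintype V] where
  /-- the basis -/
  b : Module.Basis ι K A
  /-- starting vertex -/
  src : ι → V
  /-- ending vertex -/
  tgt : ι → V
  /-- length -/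
  len : ι → ℕ
  /-- trivial paths -/
  e : V → ι
  len_e : ∀ v, len (e v) = 0
  src_e : ∀ v, src (e v) = v
  tgt_e : ∀ v, tgt (e v) = v
  eq_e : ∀ i, len i = 0 → i = e (src i)
  sum_e : ∑ v, b (e v) = 1
  e_mul : ∀ i, b (e (tgt i)) * b i = b i
  mul_e : ∀ i, b i * b (e (src i)) = b i
  mul_of_ne : ∀ i j, src i ≠ tgt j → b i * b j = 0
  mul : ∀ i j, b i * b j = 0 ∨
    ∃ k, b i * b j = b k ∧ len k = len i + len j ∧ src k = src j ∧ tgt k = tgt i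
  factor_last : ∀ i, 0 < len i → ∃ a j, len a = 1 ∧ b i = b a * b j
  factor_first : ∀ i, 0 < len i → ∃ a j, len a = 1 ∧ b i = b j * b a
  cancel : ∀ i j i' j', b i * b j ≠ 0 → b i * b j = b i' * b j' → len i = len i' → i = i' ∧ j = j'

namespace PathBasis

variable {K A V ι : Type*} [Field K] [Ring A] [Algebra K A] [Fintype V]

/-- The path basis of the opposite algebra. -/
noncomputable def op (B : PathBasis K A V ι) : PathBasis K Aᵐᵒᵖ V ι where
  b := B.b.map (MulOpposite.opLinearEquiv K)
  src := B.tgt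
  tgt := B.src
  len := B.len
  e := B.e
  len_e := B.len_e
  src_e := B.tgt_e
  tgt_e := B.src_e
  eq_e i hi := by
    have := B.eq_e i hi
    rw [this, B.tgt_e]
  sum_e := by
    simp only [Module.Basis.map_apply]
    rw [← map_sum, B.sum_e]
    rfl
  e_mul i := by
    simp only [Module.Basis.map_apply, MulOpposite.coe_opLinearEquiv, ← MulOpposite.op_mul, B.mul_e]
  mul_e i := by
    simp only [Module.Basis.map_apply, MulOpposite.coe_opLinearEquiv, ← MulOpposite.op_mul, B.e_mul]
  mul_of_ne i j h := by
    simp only [Module.Basis.map_apply, MulOpposite.coe_opLinearEquiv, ← MulOpposite.op_mul,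
      B.mul_of_ne j i h.symm, MulOpposite.op_zero]
  mul i j := by
    simp only [Module.Basis.map_apply, MulOpposite.coe_opLinearEquiv, ← MulOpposite.op_mul,
      MulOpposite.op_inj, MulOpposite.op_eq_zero_iff]
    rcases B.mul j i with h | ⟨k, h1, h2, h3, h4⟩
    · exact Or.inl h
    · exact Or.inr ⟨k, h1, by omega, h4, h3⟩
  factor_last i hi := by
    simpa only [Module.Basis.map_apply, MulOpposite.coe_opLinearEquiv, ← MulOpposite.op_mul,
      MulOpposite.op_inj] using B.factor_first i hi
  factor_first i hi := by
    simpa only [Module.Basis.map_apply, MulOpposite.coe_opLinearEquiv, ← MulOpposite.op_mul,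
      MulOpposite.op_inj] using B.factor_last i hi
  cancel i j i' j' h0 h hl := by
    simp only [Module.Basis.map_apply, MulOpposite.coe_opLinearEquiv, ← MulOpposite.op_mul,
      MulOpposite.op_inj, ne_eq, MulOpposite.op_eq_zero_iff] at h0 h
    refine (B.cancel j i j' i' h0 h ?_).symm
    have h1 := (B.mul j i).resolve_left h0
    have h2 := (B.mul j' i').resolve_left (h ▸ h0)
    obtain ⟨k, h3, h4, -⟩ := h1
    obtain ⟨k', h5, h6, -⟩ := h2
    have : k = k' := B.b.injective (by rw [← h3, ← h5, h])
    subst this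
    omega

variable (B : PathBasis K A V ι)

theorem e_injective : Function.Injective B.e := fun v w h => by
  rw [← B.src_e v, h, B.src_e]

theorem of_eq_mul {i j k : ι} (h : B.b i = B.b j * B.b k) :
    B.len i = B.len j + B.len k ∧ B.src i = B.src k ∧ B.tgt i = B.tgt j := by
  rcases B.mul j k with h1 | ⟨l, h1, h2, h3, h4⟩
  · exact (B.b.ne_zero i (h.trans h1)).elim
  · obtain rfl : i = l := B.b.injective (h.trans h1)
    exact ⟨h2, h3, h4⟩

theorem isIdempotentElem_e (v : V) : IsIdempotentElem (B.b (B.e v)) := by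
  have := B.mul_e (B.e v)
  rwa [B.src_e] at this

/-- The span of the basis elements of length at least `k`. -/
def fil (k : ℕ) : Submodule K A := Submodule.span K (B.b '' {i | k ≤ B.len i})

theorem mem_fil {i : ι} {k : ℕ} (h : k ≤ B.len i) : B.b i ∈ B.fil k :=
  Submodule.subset_span ⟨i, h, rfl⟩

theorem fil_mul_fil (k l : ℕ) : B.fil k * B.fil l ≤ B.fil (k + l) := by
  unfold fil
  rw [Submodule.span_mul_span, Submodule.span_le]
  rintro _ ⟨_, ⟨i, hi, rfl⟩, _, ⟨j, hj, rfl⟩, rfl⟩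
  simp only [Set.mem_ofPred_eq] at hi hj
  change B.b i * B.b j ∈ _
  rcases B.mul i j with h | ⟨m, h1, h2, -⟩
  · rw [h]; exact Submodule.zero_mem _
  · rw [h1]; exact B.mem_fil (by omega)

theorem fil_zero (x : A) : x ∈ B.fil 0 := by
  simp [fil, B.b.span_eq]

theorem exists_fil_eq_bot [Finite ι] : ∃ n, B.fil n = ⊥ := by
  obtain ⟨n, hn⟩ := (Set.finite_range B.len).bddAbove
  refine ⟨n + 1, ?_⟩
  have : {i | n + 1 ≤ B.len i} = ∅ := by
    ext i
    have := hn ⟨i, rfl⟩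
    simp only [Set.mem_ofPred_eq, Set.mem_empty_iff_false, iff_false]
    omega
  rw [fil, this, Set.image_empty, Submodule.span_empty]

theorem pow_mem_fil {r : A} (hr : r ∈ B.fil 1) (n : ℕ) : r ^ n ∈ B.fil n := by
  induction n with
  | zero => exact B.fil_zero _
  | succ n ih => exact pow_succ r n ▸ B.fil_mul_fil n 1 (Submodule.mul_mem_mul ih hr)

/-- The coefficients at the trivial paths, as an algebra homomorphism. -/
noncomputable def proj : A →ₐ[K] (V → K) := by
  classical
  refine AlgHom.ofLinearMap (LinearMap.pi fun v => B.b.coord (B.e v)) ?_ ?_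
  · ext v
    rw [LinearMap.pi_apply, ← B.sum_e, map_sum, Finset.sum_eq_single v]
    · simp
    · intro w _ hw
      simp [B.e_injective.ne_iff.mpr hw]
    · simp
  · intro x y
    ext v
    -- Multiplicativity is checked on pairs of basis elements: lengths add, so a product is a
    -- trivial path only if both factors are that trivial path.
    have : (LinearMap.mul K A).compr₂ (B.b.coord (B.e v)) =
        (LinearMap.mul K K).compl₁₂ (B.b.coord (B.e v)) (B.b.coord (B.e v)) := by
      refine LinearMap.ext_basis B.b B.b fun i j => ?_
      simp only [LinearMap.compr₂_apply, LinearMap.mul_apply', LinearMap.compl₁₂_apply,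
        Module.Basis.coord_apply, Module.Basis.repr_self]
      by_cases hi : i = B.e v
      · by_cases hj : j = B.e v
        · subst hi hj
          simp [(B.isIdempotentElem_e v).eq]
        · rw [Finsupp.single_eq_of_ne' hj, mul_zero]
          rcases B.mul i j with h | ⟨k, h1, h2, h3, h4⟩
          · simp [h]
          · rw [h1, Module.Basis.repr_self, Finsupp.single_eq_of_ne']
            rintro rfl
            rw [B.len_e] at h2
            rw [B.src_e] at h3
            exact hj (h3 ▸ B.eq_e j (by omega))
      · rw [Finsupp.single_eq_of_ne' hi, zero_mul]
        rcases B.mul i j with h | ⟨k, h1, h2, h3, h4⟩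
        · simp [h]
        · rw [h1, Module.Basis.repr_self, Finsupp.single_eq_of_ne']
          rintro rfl
          rw [B.len_e] at h2
          rw [B.tgt_e] at h4
          have := B.eq_e i (by omega)
          rw [this, B.tgt_e] at h4
          exact hi (h4 ▸ this)
    exact LinearMap.congr_fun₂ this x y

theorem proj_apply (x : A) (v : V) : B.proj x v = B.b.repr x (B.e v) := rfl

theorem proj_e [DecidableEq V] (v : V) : B.proj (B.b (B.e v)) = Pi.single v 1 := by
  classical
  ext w
  rw [proj_apply, Module.Basis.repr_self, Finsupp.single_apply, Pi.single_apply]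
  simp [B.e_injective.eq_iff, eq_comm]

theorem proj_surjective : Function.Surjective B.proj := by
  classical
  intro f
  refine ⟨∑ v, f v • B.b (B.e v), ?_⟩
  rw [map_sum]
  ext w
  simp [map_smul, proj_e, Pi.single_apply]

theorem mem_ker_proj {x : A} : x ∈ RingHom.ker B.proj ↔ x ∈ B.fil 1 := by
  rw [RingHom.mem_ker, fil, Module.Basis.mem_span_image]
  constructor
  · intro h i hi
    by_contra hl
    simp only [Set.mem_ofPred_eq, not_le, Nat.lt_one_iff] at hl
    have h1 := congr_fun h (B.src i)
    rw [proj_apply, ← B.eq_e i hl] at h1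
    exact (Finsupp.mem_support_iff.mp hi) h1
  · intro h
    ext v
    rw [proj_apply]
    by_contra h1
    have h2 : 1 ≤ B.len (B.e v) := h (Finsupp.mem_support_iff.mpr h1)
    rw [B.len_e] at h2
    omega

theorem sub_mem_fil (x : A) : x - ∑ v, B.proj x v • B.b (B.e v) ∈ B.fil 1 := by
  classical
  rw [← mem_ker_proj, RingHom.mem_ker, map_sub, sub_eq_zero, map_sum]
  ext w
  simp [map_smul, proj_e, Pi.single_apply]

theorem ker_pow_le (n : ℕ) {x : A} (hx : x ∈ (RingHom.ker B.proj) ^ n) : x ∈ B.fil n := by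
  induction n generalizing x with
  | zero => exact B.fil_zero x
  | succ n ih =>
    rw [Submodule.pow_succ] at hx
    refine Submodule.mul_induction_on hx (fun a ha c hc => ?_) fun a c => Submodule.add_mem _
    exact B.fil_mul_fil n 1 (Submodule.mul_mem_mul (ih ha) (B.mem_ker_proj.mp hc))

theorem exists_ker_pow_eq_bot [Finite ι] : ∃ n, (RingHom.ker B.proj) ^ n = ⊥ := by
  obtain ⟨n, hn⟩ := B.exists_fil_eq_bot
  refine ⟨n, eq_bot_iff.mpr fun x hx => ?_⟩
  have := B.ker_pow_le n hx
  rwa [hn] at this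

theorem isNilpotent_of_mem_fil [Finite ι] {r : A} (hr : r ∈ B.fil 1) : IsNilpotent r := by
  obtain ⟨n, hn⟩ := B.exists_fil_eq_bot
  have := B.pow_mem_fil hr n
  rw [hn] at this
  exact ⟨n, this⟩

/-- Only the trivial path at the target of `i` acts on `b i`, so `x` acts on it as a scalar plus a
radical element. When the scalar is nonzero this sum is a unit, which drives `mul_b_cases`. -/
theorem mul_b_eq (x : A) (i : ι) :
    x * B.b i = (algebraMap K A (B.proj x (B.tgt i)) +
      (x - ∑ v, B.proj x v • B.b (B.e v))) * B.b i := by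
  rw [add_mul, sub_mul, Finset.sum_mul, Finset.sum_eq_single (B.tgt i), smul_mul_assoc, B.e_mul,
    ← Algebra.smul_def, add_sub_cancel]
  · intro v _ hv
    rw [smul_mul_assoc, B.mul_of_ne _ _ (by rwa [B.src_e]), smul_zero]
  · simp

theorem mul_b_cases [Finite ι] (x : A) (i : ι) :
    (∃ r ∈ B.fil 1, x * B.b i = r * B.b i) ∨ B.b i ∈ Submodule.span A {x * B.b i} := by
  have hr := B.sub_mem_fil x
  by_cases hc : B.proj x (B.tgt i) = 0
  · refine Or.inl ⟨_, hr, ?_⟩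
    rw [B.mul_b_eq, hc, map_zero, zero_add]
  · refine Or.inr (Submodule.mem_span_singleton.mpr ?_)
    have hu : IsUnit (algebraMap K A (B.proj x (B.tgt i)) +
        (x - ∑ v, B.proj x v • B.b (B.e v))) :=
      (B.isNilpotent_of_mem_fil hr).isUnit_add_left_of_commute
        ((IsUnit.mk0 _ hc).map _) (Algebra.commutes _ _).symm
    obtain ⟨u, hu⟩ := hu
    refine ⟨(u⁻¹ : Aˣ), ?_⟩
    rw [B.mul_b_eq, ← hu, smul_eq_mul, Units.inv_mul_cancel_left]

/-- `A e_v` is local, with maximal submodule the elements without constant term. -/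
theorem mem_ker_or_e_mem_span [Finite ι] (v : V) {x : A}
    (hx : x ∈ Submodule.span A {B.b (B.e v)}) :
    x ∈ RingHom.ker B.proj ∨ B.b (B.e v) ∈ Submodule.span A {x} := by
  obtain ⟨a, rfl⟩ := Submodule.mem_span_singleton.mp hx
  rw [smul_eq_mul]
  refine (B.mul_b_cases a (B.e v)).imp_left ?_
  rintro ⟨r, hr, h⟩
  rw [h, mem_ker_proj]
  exact B.fil_mul_fil 1 0 (Submodule.mul_mem_mul hr (B.fil_zero _))

/-- The maximal paths: those that every nontrivial path annihilates from the left. -/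
def maximal : Set ι := {i | ∀ j, 0 < B.len j → B.b j * B.b i = 0}

theorem mul_eq_zero_of_maximal {i : ι} (hi : i ∈ B.maximal) {r : A} (hr : r ∈ B.fil 1) :
    r * B.b i = 0 := by
  refine Submodule.span_induction (p := fun r _ => r * B.b i = 0) ?_ (zero_mul _) ?_ ?_ hr
  · rintro _ ⟨j, hj, rfl⟩
    exact hi j hj
  · intro x y _ _ hx hy
    rw [add_mul, hx, hy, add_zero]
  · intro c x _ hx
    rw [smul_mul_assoc, hx, smul_zero]

/-- Take a longest basis element of the form `u * i`. -/
theorem exists_maximal [Finite ι] (i : ι) :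
    ∃ m ∈ B.maximal, ∃ u, B.b m = B.b u * B.b i := by
  have hfin : {m | ∃ u, B.b m = B.b u * B.b i}.Finite := Set.toFinite _
  obtain ⟨m, ⟨u, hu⟩, hm⟩ := hfin.exists_maximalFor B.len _ ⟨i, B.e (B.tgt i), (B.e_mul i).symm⟩
  refine ⟨m, fun j hj => ?_, u, hu⟩
  rcases B.mul j m with h | ⟨k, h1, h2, -⟩
  · exact h
  · exfalso
    have h3 : B.b k = B.b j * B.b u * B.b i := by rw [mul_assoc, ← hu, h1]
    rcases B.mul j u with h | ⟨l, h4, -⟩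
    · rw [h, zero_mul] at h3
      exact B.b.ne_zero k h3
    · have := hm (j := k) ⟨l, by rw [h3, h4]⟩ (by omega)
      omega

/-- An element `x` of the span of the maximal paths is killed by the radical, so `f (a * x)` depends
only on the scalars `f (e_v * x)` collected in `θ`. Nondegeneracy makes `θ` injective there,
bounding the number of maximal paths by the number of vertices. Since each vertex is the source of
some maximal path, `src` is a surjection that this bound makes bijective. -/
theorem src_injOn_maximal [Finite ι] {f : A →ₗ[K] K} (hf : ∀ a, (∀ x, f (x * a) = 0) → a = 0) :
    Set.InjOn B.src B.maximal := by
  classical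
  have := Fintype.ofFinite ι
  let θ : A →ₗ[K] (V → K) := LinearMap.pi fun v => f ∘ₗ LinearMap.mulLeft K (B.b (B.e v))
  have hind : LinearIndependent K (fun m : B.maximal => B.b m) :=
    B.b.linearIndependent.comp _ Subtype.val_injective
  have hdis : Disjoint (Submodule.span K (Set.range fun m : B.maximal => B.b m))
      (LinearMap.ker θ) := by
    refine Submodule.disjoint_def.mpr fun x hx hx' => hf x fun a => ?_
    have h1 : ∀ r ∈ B.fil 1, r * x = 0 := by
      intro r hr
      refine Submodule.span_induction (p := fun x _ => r * x = 0) ?_ (mul_zero _) ?_ ?_ hx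
      · rintro _ ⟨j, rfl⟩
        exact B.mul_eq_zero_of_maximal j.2 hr
      · intro x y _ _ hx hy
        rw [mul_add, hx, hy, add_zero]
      · intro c x _ hx
        rw [mul_smul_comm, hx, smul_zero]
    have h2 := h1 _ (B.sub_mem_fil a)
    rw [sub_mul, sub_eq_zero] at h2
    rw [h2, Finset.sum_mul, map_sum]
    refine Finset.sum_eq_zero fun v _ => ?_
    have h3 : f (B.b (B.e v) * x) = 0 := congr_fun hx' v
    rw [smul_mul_assoc, map_smul, h3, smul_zero]
  have hcard := (hind.map hdis).fintype_card_le_finrank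
  rw [Module.finrank_fintype_fun_eq_card] at hcard
  have hsurj : Function.Surjective fun m : B.maximal => B.src m := by
    intro v
    obtain ⟨m, hm, u, hu⟩ := B.exists_maximal (B.e v)
    exact ⟨⟨m, hm⟩, (B.of_eq_mul hu).2.1.trans (B.src_e v)⟩
  have hbij := hsurj.bijective_of_nat_card_le
    (by simpa only [Nat.card_eq_fintype_card] using hcard)
  intro m hm m' hm' h
  exact congrArg Subtype.val (@hbij.1 ⟨m, hm⟩ ⟨m', hm'⟩ h)

/-- There is at most one path of each length out of each vertex. -/
def Serial : Prop := ∀ i j, B.src i = B.src j → B.len i = B.len j → i = j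

/-- Both paths extend to the same maximal path, and a path has only one initial segment of a given
length. -/
theorem serial_of_functional [Finite ι] {f : A →ₗ[K] K}
    (hf : ∀ a, (∀ x, f (x * a) = 0) → a = 0) : B.Serial := by
  intro i j hs hl
  obtain ⟨m, hm, u, hu⟩ := B.exists_maximal i
  obtain ⟨m', hm', u', hu'⟩ := B.exists_maximal j
  obtain ⟨h1, h2, -⟩ := B.of_eq_mul hu
  obtain ⟨h1', h2', -⟩ := B.of_eq_mul hu'
  obtain rfl : m = m' := B.src_injOn_maximal hf hm hm' (by rw [h2, h2', hs])
  exact (B.cancel _ _ _ _ (hu ▸ B.b.ne_zero m) (hu.symm.trans hu') (by omega)).2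

variable {B}

theorem Serial.total [Finite ι] (hB : B.Serial) (v : V)
    (N N' : Submodule A (Submodule.span A {B.b (B.e v)})) : N ≤ N' ∨ N' ≤ N := by
  classical
  -- `y k` is the only path of length `k` out of `v`, or `0` when there is none; these are the
  -- generators of the chain.
  have hy : ∃ y : ℕ → A, (∀ i, B.src i = v → B.b i = y (B.len i)) ∧
      ∀ k, y k = 0 ∨ ∃ i, B.src i = v ∧ B.len i = k ∧ y k = B.b i := by
    refine ⟨fun k => if h : ∃ i, B.src i = v ∧ B.len i = k then B.b h.choose else 0,
      fun i hi => ?_, fun k => ?_⟩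
    · have h : ∃ j, B.src j = v ∧ B.len j = B.len i := ⟨i, hi, rfl⟩
      simp only [dif_pos h]
      exact congrArg B.b (hB i _ (hi.trans h.choose_spec.1.symm) h.choose_spec.2.symm)
    · by_cases h : ∃ i, B.src i = v ∧ B.len i = k
      · exact Or.inr ⟨h.choose, h.choose_spec.1, h.choose_spec.2, by simp only [dif_pos h]⟩
      · exact Or.inl (by simp only [dif_neg h])
  obtain ⟨y, hy1, hy2⟩ := hy
  have hy0 : y 0 = B.b (B.e v) := by
    have := hy1 (B.e v) (B.src_e v)
    rw [this, B.len_e]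
  obtain ⟨n, hn⟩ := B.exists_fil_eq_bot
  refine Submodule.total_of_le _ (fun N N' hN hN' =>
    total_of_generators y (n := n) ?_ ?_ ?_ (hy0 ▸ hN) (hy0 ▸ hN')) N N'
  · rcases hy2 n with h | ⟨i, -, h2, h3⟩
    · exact h
    · have := B.mem_fil h2.ge
      rw [hn] at this
      rw [h3]
      exact this
  · intro k
    rcases hy2 (k + 1) with h | ⟨i, h1, h2, h3⟩
    · rw [h]; exact Submodule.zero_mem _
    · obtain ⟨a, j, ha, hj⟩ := B.factor_last i (by omega)
      obtain ⟨h4, h5, -⟩ := B.of_eq_mul hj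
      refine Submodule.mem_span_singleton.mpr ⟨B.b a, ?_⟩
      rw [h3, hj, hy1 j (by rw [← h5, h1]), smul_eq_mul]
      congr 2
      omega
  · intro k x
    rcases hy2 k with h | ⟨i, h1, h2, h3⟩
    · left; rw [h, smul_zero]; exact Submodule.zero_mem _
    · rw [h3, smul_eq_mul]
      refine (B.mul_b_cases x i).imp_left ?_
      rintro ⟨r, hr, h⟩
      rw [h]
      -- A radical element is a combination of paths `l * a` beginning with an arrow `a`, and `a * b
      -- i` is either zero or the next path `y (k + 1)`.
      refine Submodule.span_induction
        (p := fun r _ => r * B.b i ∈ Submodule.span A {y (k + 1)}) ?_ ?_ ?_ ?_ hr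
      · rintro _ ⟨j, hj, rfl⟩
        obtain ⟨a, l, ha, hl⟩ := B.factor_first j hj
        rw [hl, mul_assoc]
        refine Submodule.smul_mem _ (B.b l) ?_
        rcases B.mul a i with h4 | ⟨m, h4, h5, h6, -⟩
        · rw [h4]; exact Submodule.zero_mem _
        · rw [h4, hy1 m (h6.trans h1), h5, ha, h2, add_comm]
          exact Submodule.mem_span_singleton_self _
      · rw [zero_mul]; exact Submodule.zero_mem _
      · intro x y _ _ hx hy
        rw [add_mul]; exact Submodule.add_mem _ hx hy
      · intro c x _ hx
        rw [smul_mul_assoc]; exact Submodule.smul_of_tower_mem _ c hx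

theorem Serial.hasUniqueCompositionSeries [Finite ι] (hB : B.Serial) (P : Type*) [AddCommGroup P]
    [Module A P] [Module.Projective A P] (hP : IsIndecomposableModule A P) :
    HasUniqueCompositionSeries A P := by
  have : Module.Finite K A := Module.Finite.of_basis B.b
  have : IsNoetherianRing A := isNoetherian_of_tower K inferInstance
  have : IsArtinianRing A := isArtinian_of_tower K inferInstance
  obtain ⟨n, hn⟩ := B.exists_ker_pow_eq_bot
  obtain ⟨v, ⟨g⟩⟩ := hP.exists_equiv_span B.isIdempotentElem_e B.sum_e
    (fun v => B.b.ne_zero _) hn fun v x hx => B.mem_ker_or_e_mem_span v hx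
  have : IsNoetherian A P := isNoetherian_of_linearEquiv g.symm
  have : IsArtinian A P := isArtinian_of_linearEquiv g.symm
  exact hasUniqueCompositionSeries_of_total (g.symm.total_submodule (hB.total v))

variable (B)

/-- The kernel consists of nilpotents, so `1 + y * x` is a unit for `x` in it. Conversely a
surjection carries the radical into the radical of `V → K`, which is zero. -/
theorem ker_proj_eq_jacobson [Finite ι] : RingHom.ker B.proj = Ring.jacobson A := by
  apply le_antisymm
  · intro x hx
    rw [← Ideal.jacobson_bot, Ideal.mem_jacobson_iff]
    intro y
    have hn := B.isNilpotent_of_mem_fil (B.mem_ker_proj.mp ((RingHom.ker B.proj).mul_mem_left y hx))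
    obtain ⟨u, hu⟩ := hn.isUnit_add_one
    refine ⟨(u⁻¹ : Aˣ), ?_⟩
    rw [mul_assoc, ← mul_add_one, ← hu, Units.inv_mul, sub_self]
    exact Submodule.zero_mem _
  · intro x hx
    have : RingHomSurjective (B.proj : A →+* (V → K)) := ⟨B.proj_surjective⟩
    have h1 := Ring.le_comap_jacobson (B.proj : A →+* (V → K)) hx
    rw [Ideal.mem_comap, IsSemisimpleRing.jacobson_eq_bot] at h1
    exact h1

theorem isElementaryAlgebra {K A V ι : Type*} [Field K] [Ring A] [Algebra K A] [Fintype V]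
    (B : PathBasis K A V ι) [Finite ι] : IsElementaryAlgebra K A :=
  ⟨Fintype.card V, ⟨(Ideal.quotientEquivAlgOfEq K B.ker_proj_eq_jacobson.symm).trans
    ((Ideal.quotientKerAlgEquivOfSurjective B.proj_surjective).trans
      (AlgEquiv.piCongrLeft' K (fun _ => K) (Fintype.equivFin V)))⟩⟩

theorem isNakayamaAlgebra {K A V ι : Type*} [Field K] [Ring A] [Algebra K A] [Fintype V]
    (B : PathBasis K A V ι) [Finite ι]
    {f : A →ₗ[K] K}
    (hf : ∀ a, (∀ x, f (x * a) = 0) → a = 0) (hf' : ∀ a, (∀ x, f (a * x) = 0) → a = 0) :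
    IsNakayamaAlgebra A := by
  -- Passing to the opposite algebra exchanges the two nondegeneracy conditions.
  have h2 : B.op.Serial := by
    refine B.op.serial_of_functional
      (f := f ∘ₗ (MulOpposite.opLinearEquiv K).symm.toLinearMap) fun a h => ?_
    rw [← MulOpposite.unop_eq_zero_iff]
    exact hf' _ fun x => h (MulOpposite.op x)
  exact ⟨fun P _ _ _ hP => (B.serial_of_functional hf).hasUniqueCompositionSeries P hP,
    fun P _ _ _ hP => h2.hasUniqueCompositionSeries P hP⟩

end PathBasis

/-- The form is `φ 1`, since `φ a x = φ 1 (x * a)`. Injectivity of `φ` gives one nondegeneracy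
condition; surjectivity gives the other, because then an element orthogonal to everything is killed
by all functionals. -/
theorem IsFrobeniusAlgebra.exists_functional {K A : Type*} [Field K] [Ring A] [Algebra K A]
    [FiniteDimensional K A] (h : IsFrobeniusAlgebra K A) :
    ∃ f : A →ₗ[K] K, (∀ a, (∀ x, f (x * a) = 0) → a = 0) ∧ (∀ a, (∀ x, f (a * x) = 0) → a = 0) := by
  obtain ⟨φ, hφ⟩ := h
  have h1 (a x : A) : φ a x = φ 1 (x * a) := by rw [← hφ, mul_one]
  refine ⟨φ 1, fun a ha => φ.map_eq_zero_iff.mp ?_, fun a ha => ?_⟩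
  · ext x
    rw [h1, ha, LinearMap.zero_apply]
  · refine (Module.forall_dual_apply_eq_zero_iff K a).mp fun g => ?_
    obtain ⟨x, rfl⟩ := φ.surjective g
    rw [h1, ha]

/-! ### Paths, and subspaces of the path algebra spanned by paths. -/

namespace Quiver.Path

/-- Unique factorization of a path at a given length. Bundled paths are compared because the
intermediate vertices are not known to agree beforehand. -/
theorem quiverPath_eq_of_comp_eq {V : Type*} [Quiver V] {a b b' c : V} {p : Path a b}
    {q : Path b c} {p' : Path a b'} {q' : Path b' c} (hl : q.length = q'.length)
    (h : p.comp q = p'.comp q') :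
    QuiverPath.mk a b p = QuiverPath.mk a b' p' ∧ QuiverPath.mk b c q = QuiverPath.mk b' c q' := by
  induction q with
  | nil =>
    cases q' with
    | nil => simp only [comp_nil] at h; subst h; exact ⟨rfl, rfl⟩
    | cons q' f' => simp at hl
  | cons q f ih =>
    cases q' with
    | nil => simp at hl
    | cons q' f' =>
      simp only [comp_cons] at h
      simp only [length_cons, add_left_inj] at hl
      injection h with h1 _ h2 h3
      subst h1
      obtain ⟨h4, h5⟩ := ih hl (eq_of_heq h2)
      refine ⟨h4, ?_⟩
      injection h5 with h6 _ h7
      subst h6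
      rw [eq_of_heq h7, eq_of_heq h3]

end Quiver.Path

namespace PathAlgebra

variable (K : Type*) [Field K] (V : Type*) [Quiver V]

/-- The basis of the path algebra consisting of all paths. -/
noncomputable def pathsBasis : Module.Basis (QuiverPath V) K (PathAlgebra K V) :=
  (Finsupp.basisSingleOne : Module.Basis (QuiverPath V) K (QuiverPath V →₀ K))

variable {V}

@[simp]
theorem pathsBasis_apply (p : QuiverPath V) : pathsBasis K V p = ofPath K p :=
  congr_fun (Finsupp.coe_basisSingleOne (R := K)) p

theorem ofPath_mul_cases (q p : QuiverPath V) : ofPath K q * ofPath K p = 0 ∨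
    ∃ (a b c : V) (p' : Quiver.Path a b) (q' : Quiver.Path b c), p = ⟨a, b, p'⟩ ∧ q = ⟨b, c, q'⟩ := by
  obtain ⟨a, b, p⟩ := p
  obtain ⟨b', c, q⟩ := q
  by_cases h : b = b'
  · subst h
    exact Or.inr ⟨a, b, c, p, q, rfl, rfl⟩
  · exact Or.inl (ofPath_mul_of_ne K h)

/-- A set of paths is absorbing if it is closed under composing with arbitrary paths. -/
def IsAbsorbing (T : Set (QuiverPath V)) : Prop :=
  ∀ (a b c : V) (p : Quiver.Path a b) (q : Quiver.Path b c),
    (⟨a, b, p⟩ ∈ T ∨ ⟨b, c, q⟩ ∈ T) → (⟨a, c, p.comp q⟩ : QuiverPath V) ∈ T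

/-- The subspace spanned by a set of paths. -/
noncomputable def pathSpan (T : Set (QuiverPath V)) : Submodule K (PathAlgebra K V) :=
  Submodule.span K (pathsBasis K V '' T)

variable {K}

theorem mem_pathSpan {T : Set (QuiverPath V)} {x : PathAlgebra K V} :
    x ∈ pathSpan K T ↔ ∀ p, (pathsBasis K V).repr x p ≠ 0 → p ∈ T := by
  rw [pathSpan, Module.Basis.mem_span_image]
  simp [Set.subset_def]

theorem ofPath_mem_pathSpan {T : Set (QuiverPath V)} {p : QuiverPath V} (hp : p ∈ T) :
    ofPath K p ∈ pathSpan K T :=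
  Submodule.subset_span ⟨p, hp, pathsBasis_apply K p⟩

theorem mem_of_ofPath_mem_pathSpan {T : Set (QuiverPath V)} {p : QuiverPath V}
    (hp : ofPath K p ∈ pathSpan K T) : p ∈ T := by
  refine mem_pathSpan.mp hp p ?_
  rw [← pathsBasis_apply, Module.Basis.repr_self, Finsupp.single_eq_same]
  exact one_ne_zero

theorem pathSpan_induction {T : Set (QuiverPath V)} {P : PathAlgebra K V → Prop} (h0 : P 0)
    (hadd : ∀ x y, P x → P y → P (x + y)) (hs : ∀ (c : K) x, P x → P (c • x))
    (hT : ∀ p ∈ T, P (ofPath K p)) {x : PathAlgebra K V} (hx : x ∈ pathSpan K T) : P x := by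
  refine Submodule.span_induction (p := fun x _ => P x) ?_ h0 (fun x y _ _ => hadd x y)
    (fun c x _ => hs c x) hx
  rintro _ ⟨p, hp, rfl⟩
  rw [pathsBasis_apply]
  exact hT p hp

theorem isAbsorbing_length (k : ℕ) : IsAbsorbing {p : QuiverPath V | k ≤ p.path.length} := by
  intro a b c p q h
  simp only [Set.mem_ofPred_eq] at h
  simp only [Set.mem_ofPred_eq, Quiver.Path.length_comp]
  omega

variable [Fintype V]

theorem IsAbsorbing.mul_mem_left {T : Set (QuiverPath V)} (hT : IsAbsorbing T)
    (y : PathAlgebra K V) {x : PathAlgebra K V} (hx : x ∈ pathSpan K T) : y * x ∈ pathSpan K T := by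
  refine pathSpan_induction (P := fun x => y * x ∈ pathSpan K T) ?_ ?_ ?_ ?_ hx
  · rw [mul_zero]; exact Submodule.zero_mem _
  · intro x z hx hz
    rw [mul_add]; exact Submodule.add_mem _ hx hz
  · intro c x hx
    rw [mul_smul_comm]; exact Submodule.smul_mem _ c hx
  · intro p hp
    induction y using PathAlgebra.induction with
    | h0 => rw [zero_mul]; exact Submodule.zero_mem _
    | hadd x z hx hz => rw [add_mul]; exact Submodule.add_mem _ hx hz
    | hs c q =>
      rw [smul_mul_assoc]
      refine Submodule.smul_mem _ c ?_
      rcases ofPath_mul_cases K q p with h | ⟨a, b, d, p', q', rfl, rfl⟩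
      · rw [h]; exact Submodule.zero_mem _
      · rw [ofPath_mul_of_eq]
        exact ofPath_mem_pathSpan (hT _ _ _ _ _ (Or.inl hp))

theorem IsAbsorbing.mul_mem_right {T : Set (QuiverPath V)} (hT : IsAbsorbing T)
    (y : PathAlgebra K V) {x : PathAlgebra K V} (hx : x ∈ pathSpan K T) : x * y ∈ pathSpan K T := by
  refine pathSpan_induction (P := fun x => x * y ∈ pathSpan K T) ?_ ?_ ?_ ?_ hx
  · rw [zero_mul]; exact Submodule.zero_mem _
  · intro x z hx hz
    rw [add_mul]; exact Submodule.add_mem _ hx hz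
  · intro c x hx
    rw [smul_mul_assoc]; exact Submodule.smul_mem _ c hx
  · intro p hp
    induction y using PathAlgebra.induction with
    | h0 => rw [mul_zero]; exact Submodule.zero_mem _
    | hadd x z hx hz => rw [mul_add]; exact Submodule.add_mem _ hx hz
    | hs c q =>
      rw [mul_smul_comm]
      refine Submodule.smul_mem _ c ?_
      rcases ofPath_mul_cases K p q with h | ⟨a, b, d, p', q', rfl, rfl⟩
      · rw [h]; exact Submodule.zero_mem _
      · rw [ofPath_mul_of_eq]
        exact ofPath_mem_pathSpan (hT _ _ _ _ _ (Or.inr hp))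

/-- The span of an absorbing set is itself a two-sided ideal, so membership in an ideal generated by
paths can be tested coefficient by coefficient. -/
theorem mem_pathSpan_of_mem_pathIdeal {S T : Set (QuiverPath V)} (hT : IsAbsorbing T) (hS : S ⊆ T)
    {x : PathAlgebra K V} (hx : x ∈ pathIdeal K S) : x ∈ pathSpan K T := by
  let I : TwoSidedIdeal (PathAlgebra K V) :=
    TwoSidedIdeal.mk' (pathSpan K T) (Submodule.zero_mem _) (Submodule.add_mem _)
      (Submodule.neg_mem _) (fun h => hT.mul_mem_left _ h) (fun h => hT.mul_mem_right _ h)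
  have hI (x) : x ∈ I ↔ x ∈ pathSpan K T := TwoSidedIdeal.mem_mk' ..
  rw [← hI]
  refine TwoSidedIdeal.span_le.mpr ?_ hx
  rintro _ ⟨p, hp, rfl⟩
  exact (hI _).mpr (ofPath_mem_pathSpan (hS hp))

theorem isAbsorbing_setOf_ofPath_mem (I : TwoSidedIdeal (PathAlgebra K V)) :
    IsAbsorbing {p | ofPath K p ∈ I} := by
  intro a b c p q h
  change ofPath K _ ∈ I
  rw [← ofPath_mul_of_eq]
  rcases h with h | h
  · exact I.mul_mem_left _ _ h
  · exact I.mul_mem_right _ _ h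

theorem mul_mem_pathSpan_length {k l : ℕ} {x y : PathAlgebra K V}
    (hx : x ∈ pathSpan K {p | k ≤ p.path.length}) (hy : y ∈ pathSpan K {p | l ≤ p.path.length}) :
    x * y ∈ pathSpan K {p | k + l ≤ p.path.length} := by
  have := Submodule.mul_mem_mul hx hy
  rw [pathSpan, pathSpan, Submodule.span_mul_span] at this
  refine Submodule.span_le.mpr ?_ this
  rintro _ ⟨_, ⟨q, hq, rfl⟩, _, ⟨p, hp, rfl⟩, rfl⟩
  change pathsBasis K V q * pathsBasis K V p ∈ _
  rw [pathsBasis_apply, pathsBasis_apply]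
  rcases ofPath_mul_cases K q p with h | ⟨a, b, d, p', q', rfl, rfl⟩
  · rw [h]; exact Submodule.zero_mem _
  · rw [ofPath_mul_of_eq]
    refine ofPath_mem_pathSpan ?_
    simp only [Set.mem_ofPred_eq] at hp hq
    simp only [Set.mem_ofPred_eq, Quiver.Path.length_comp]
    omega

theorem arrowIdeal_sq_le {x : PathAlgebra K V} (hx : x ∈ (arrowIdeal K V).asIdeal ^ 2) :
    x ∈ pathSpan K {p | 2 ≤ p.path.length} := by
  have h1 : ∀ y ∈ (arrowIdeal K V).asIdeal, y ∈ pathSpan K {p | 1 ≤ p.path.length} := by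
    intro y hy
    refine mem_pathSpan_of_mem_pathIdeal (isAbsorbing_length 1) ?_ (TwoSidedIdeal.mem_asIdeal.mp hy)
    rintro _ ⟨a, b, f, rfl⟩
    exact le_refl 1
  -- The square unfolds to `J ^ 0 * J * J`, where the factor from `J ^ 0` is arbitrary; hence the
  -- second induction.
  rw [Submodule.pow_succ, Submodule.pow_succ] at hx
  refine Submodule.mul_induction_on hx (fun a ha c hc => ?_) fun a c => Submodule.add_mem _
  refine mul_mem_pathSpan_length (k := 1) (l := 1) ?_ (h1 c hc)
  refine Submodule.mul_induction_on ha (fun a ha c hc => ?_) fun a c => Submodule.add_mem _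
  exact (isAbsorbing_length 1).mul_mem_left a (h1 c hc)

theorem ofPath_mem_arrowIdeal_pow (n : ℕ) {p : QuiverPath V} (hp : n ≤ p.path.length) :
    ofPath K p ∈ (arrowIdeal K V).asIdeal ^ n := by
  have key : ∀ (n : ℕ) (p : QuiverPath V), p.path.length = n →
      ofPath K p ∈ (arrowIdeal K V).asIdeal ^ n := by
    intro n
    induction n with
    | zero =>
      intro p _
      rw [Submodule.pow_zero, Submodule.one_eq_span]
      exact Submodule.mem_span_singleton.mpr ⟨_, mul_one _⟩
    | succ n ih =>
      rintro ⟨a, b, p⟩ hp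
      obtain ⟨c, f, p', h1, rfl⟩ := p.eq_toPath_comp_of_length_eq_succ hp
      rw [← ofPath_mul_of_eq, Submodule.pow_succ]
      refine Submodule.mul_mem_mul (ih _ h1) ?_
      exact TwoSidedIdeal.mem_asIdeal.mpr (TwoSidedIdeal.subset_span ⟨_, ⟨_, _, f, rfl⟩, rfl⟩)
  obtain ⟨a, b, p⟩ := p
  obtain ⟨c, p₁, p₂, rfl, h⟩ := p.exists_eq_comp_of_le_length hp
  rw [← ofPath_mul_of_eq]
  exact Ideal.mul_mem_left _ _ (key n ⟨a, c, p₁⟩ h)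

end PathAlgebra

/-! ### The path basis of a monomial algebra. -/

open PathAlgebra in
theorem IsMonomialAlgebra.nonempty_pathBasis {K A : Type*} [Field K] [Ring A] [Algebra K A]
    (h : IsMonomialAlgebra K A) :
    ∃ (V : Type) (_ : Fintype V) (ι : Type), Nonempty (PathBasis K A V ι) := by
  obtain ⟨V, _, _, -, S, ⟨N, -, -, hI2⟩, ⟨g⟩⟩ := h
  let π : PathAlgebra K V →ₐ[K] A :=
    (g.symm : _ →ₐ[K] A).comp (Ideal.Quotient.mkₐ K (pathIdeal K S).asIdeal)
  have hπs : Function.Surjective π := g.symm.surjective.comp Ideal.Quotient.mk_surjective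
  have hπ (x) : π x = 0 ↔ x ∈ pathIdeal K S := by
    rw [← TwoSidedIdeal.mem_asIdeal, ← Ideal.Quotient.eq_zero_iff_mem]
    exact g.symm.map_eq_zero_iff
  -- `T` is the set of all paths in the ideal, not just the given generators. It is absorbing and
  -- spans the kernel of `π`, so the remaining paths map to a basis of `A`.
  let T : Set (QuiverPath V) := {p | ofPath K p ∈ pathIdeal K S}
  have hT : IsAbsorbing T := isAbsorbing_setOf_ofPath_mem _
  have hTI {x} (hx : π x = 0) : x ∈ pathSpan K T :=
    mem_pathSpan_of_mem_pathIdeal hT (fun p hp => TwoSidedIdeal.subset_span ⟨p, hp, rfl⟩)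
      ((hπ x).mp hx)
  have hπT {p} : π (ofPath K p) = 0 ↔ p ∈ T := hπ _
  -- The upper half of admissibility keeps trivial paths out of `T`, so they survive in `A`.
  have hlen {p} (hp : p ∈ T) : 2 ≤ p.path.length :=
    mem_of_ofPath_mem_pathSpan (T := {p | 2 ≤ p.path.length})
      (arrowIdeal_sq_le (hI2 (TwoSidedIdeal.mem_asIdeal.mpr hp)))
  let ι := {p // p ∉ T}
  have hli : LinearIndependent K fun i : ι => π (ofPath K i.1) := by
    have h1 : LinearIndependent K fun i : ι => pathsBasis K V i.1 :=
      (pathsBasis K V).linearIndependent.comp _ Subtype.val_injective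
    have h2 : Disjoint (Submodule.span K (Set.range fun i : ι => pathsBasis K V i.1))
        (LinearMap.ker π.toLinearMap) := by
      refine Submodule.disjoint_def.mpr fun x hx hx' => ?_
      have h3 : x ∈ pathSpan K Tᶜ := by
        refine Submodule.span_mono ?_ hx
        rintro _ ⟨i, rfl⟩
        exact ⟨i.1, i.2, rfl⟩
      have h4 := hTI (x := x) hx'
      refine (pathsBasis K V).ext_elem fun p => ?_
      by_contra h5
      rw [map_zero, Finsupp.zero_apply] at h5
      exact mem_pathSpan.mp h3 p h5 (mem_pathSpan.mp h4 p h5)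
    have h3 := h1.map h2
    simpa only [Function.comp_def, pathsBasis_apply, AlgHom.toLinearMap_apply] using h3
  have hsp : ⊤ ≤ Submodule.span K (Set.range fun i : ι => π (ofPath K i.1)) := by
    rintro a -
    obtain ⟨x, rfl⟩ := hπs a
    induction x using PathAlgebra.induction with
    | h0 => rw [map_zero]; exact Submodule.zero_mem _
    | hadd x y hx hy => rw [map_add]; exact Submodule.add_mem _ hx hy
    | hs c p =>
      rw [map_smul]
      refine Submodule.smul_mem _ c ?_
      by_cases hp : p ∈ T
      · rw [hπT.mpr hp]; exact Submodule.zero_mem _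
      · exact Submodule.subset_span ⟨⟨p, hp⟩, rfl⟩
  let b : Module.Basis ι K A := Module.Basis.mk hli hsp
  have hb (i : ι) : b i = π (ofPath K i.1) := Module.Basis.mk_apply ..
  refine ⟨V, inferInstance, ι, ⟨{
    b := b
    src := fun i => i.1.src
    tgt := fun i => i.1.tgt
    len := fun i => i.1.path.length
    e := fun v => ⟨idPath v, fun h => by simpa [idPath] using hlen h⟩
    len_e := fun v => rfl
    src_e := fun v => rfl
    tgt_e := fun v => rfl
    eq_e := ?_
    sum_e := ?_
    e_mul := ?_
    mul_e := ?_
    mul_of_ne := ?_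
    mul := ?_
    factor_last := ?_
    factor_first := ?_
    cancel := ?_ }⟩⟩
  · rintro ⟨⟨a, c, p⟩, hp⟩ h
    cases p with
    | nil => rfl
    | cons p f => simp at h
  · simp only [hb, ← map_sum]
    rw [← one_def, map_one]
  · rintro ⟨⟨a, c, p⟩, hp⟩
    rw [hb, hb, ← map_mul]
    exact congrArg π (ofPath_mul_of_eq K p .nil)
  · rintro ⟨⟨a, c, p⟩, hp⟩
    rw [hb, hb, ← map_mul]
    refine congrArg π ((ofPath_mul_of_eq K .nil p).trans ?_)
    rw [Quiver.Path.nil_comp]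
  · intro i j hij
    rw [hb, hb, ← map_mul, ofPath_mul_of_ne K hij.symm, map_zero]
  · rintro ⟨q, hq⟩ ⟨p, hp⟩
    rw [hb, hb, ← map_mul]
    rcases ofPath_mul_cases K q p with h | ⟨a, c, d, p, q, rfl, rfl⟩
    · left; rw [h, map_zero]
    · rw [ofPath_mul_of_eq]
      by_cases h : (⟨a, d, p.comp q⟩ : QuiverPath V) ∈ T
      · exact Or.inl (hπT.mpr h)
      · refine Or.inr ⟨⟨_, h⟩, (hb ⟨_, h⟩).symm, ?_, rfl, rfl⟩
        simp only [Quiver.Path.length_comp]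
        omega
  · rintro ⟨⟨a, c, p⟩, hp⟩ h
    cases p with
    | nil => simp at h
    | @cons d _ p f =>
      refine ⟨⟨⟨_, _, f.toPath⟩, fun h => hp (hT _ _ _ p f.toPath (Or.inr h))⟩,
        ⟨⟨_, _, p⟩, fun h => hp (hT _ _ _ p f.toPath (Or.inl h))⟩, rfl, ?_⟩
      rw [hb, hb, hb, ← map_mul, ofPath_mul_of_eq]
      rfl
  · rintro ⟨⟨a, c, p⟩, hp⟩ h
    obtain ⟨d, f, p', -, rfl⟩ := p.eq_toPath_comp_of_length_eq_succ (Nat.succ_pred_eq_of_pos h).symm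
    refine ⟨⟨⟨_, _, f.toPath⟩, fun h => hp (hT _ _ _ f.toPath p' (Or.inl h))⟩,
      ⟨⟨_, _, p'⟩, fun h => hp (hT _ _ _ f.toPath p' (Or.inr h))⟩, rfl, ?_⟩
    rw [hb, hb, hb, ← map_mul, ofPath_mul_of_eq]
  · rintro ⟨q, hq⟩ ⟨p, hp⟩ ⟨q', hq'⟩ ⟨p', hp'⟩ h0 h hl
    simp only [hb, ← map_mul] at h0 h
    rcases ofPath_mul_cases K q p with h1 | ⟨x, y, z, p, q, rfl, rfl⟩
    · exact (h0 (by rw [h1, map_zero])).elim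
    rcases ofPath_mul_cases K q' p' with h1 | ⟨x', y', z', p', q', rfl, rfl⟩
    · exact (h0 (by rw [h, h1, map_zero])).elim
    rw [ofPath_mul_of_eq] at h0 h
    rw [ofPath_mul_of_eq] at h
    have h1 := mt hπT.mpr h0
    have h2 := mt hπT.mpr (h ▸ h0)
    have h3 : (⟨_, h1⟩ : ι) = ⟨_, h2⟩ := b.injective (by rw [hb, hb]; exact h)
    have h4 := congrArg Subtype.val h3
    injection h4 with h5 h6 h7
    subst h5 h6
    obtain ⟨h8, h9⟩ := Quiver.Path.quiverPath_eq_of_comp_eq hl (eq_of_heq h7)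
    exact ⟨Subtype.ext h9, Subtype.ext h8⟩

/-! ### Left integrals and the Frobenius property of Hopf algebras. -/

section HopfFrobenius

open TensorProduct Coalgebra HopfAlgebra

variable {K H : Type*} [Field K] [Ring H] [HopfAlgebra K H]

/-- Coassociativity in Sweedler form. The computations below pick a linear map `F` on the triple
tensor product and evaluate it in both bracketings. -/
theorem sum_assoc_comul_tmul {M ι : Type*} [AddCommGroup M] [Module K M] {h : H}
    (r : Repr K h ι) (F : H ⊗[K] (H ⊗[K] H) →ₗ[K] M) :
    ∑ i ∈ r.index, F (TensorProduct.assoc K H H H (comul (r.left i) ⊗ₜ r.right i)) =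
      ∑ i ∈ r.index, F (r.left i ⊗ₜ comul (r.right i)) := by
  have := congrArg F (coassoc_apply (R := K) h)
  rw [← r.eq] at this
  simpa only [map_sum, LinearMap.rTensor_tmul, LinearMap.lTensor_tmul] using this

theorem sum_counit_right_smul {ι : Type*} {h : H} (r : Repr K h ι) :
    ∑ i ∈ r.index, counit (R := K) (r.right i) • r.left i = h := by
  have := congrArg (TensorProduct.rid K H) (sum_tmul_counit_eq r)
  simpa only [map_sum, TensorProduct.rid_tmul, one_smul] using this

/-- Evaluation of the second tensor factor at a functional. -/
noncomputable def evalSnd (f : Module.Dual K H) : H ⊗[K] H →ₗ[K] H :=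
  (TensorProduct.rid K H).toLinearMap ∘ₗ f.lTensor H

@[simp]
theorem evalSnd_tmul (f : Module.Dual K H) (x y : H) : evalSnd f (x ⊗ₜ y) = f y • x := by
  simp [evalSnd]

theorem evalSnd_lTensor (f : Module.Dual K H) (g : H →ₗ[K] H) (t : H ⊗[K] H) :
    evalSnd f (g.lTensor H t) = evalSnd (f ∘ₗ g) t := by
  induction t with
  | zero => simp
  | tmul x y => simp
  | add x y hx hy => simp only [map_add, hx, hy]

theorem evalSnd_tmul_one_mul (f : Module.Dual K H) (g : H) (t : H ⊗[K] H) :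
    evalSnd f ((g ⊗ₜ 1) * t) = g * evalSnd f t := by
  induction t with
  | zero => simp
  | tmul x y => simp
  | add x y hx hy => simp only [mul_add, map_add, hx, hy]

theorem evalSnd_one_tmul_mul (f : Module.Dual K H) (g : H) (t : H ⊗[K] H) :
    evalSnd f ((1 ⊗ₜ g) * t) = evalSnd (f ∘ₗ LinearMap.mulLeft K g) t := by
  induction t with
  | zero => simp
  | tmul x y => simp
  | add x y hx hy => simp only [mul_add, map_add, hx, hy]

theorem evalSnd_mul_one_tmul (f : Module.Dual K H) (g : H) (t : H ⊗[K] H) :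
    evalSnd f (t * (1 ⊗ₜ g)) = evalSnd (f ∘ₗ LinearMap.mulRight K g) t := by
  induction t with
  | zero => simp
  | tmul x y => simp
  | add x y hx hy => simp only [add_mul, map_add, hx, hy]

/-- A left integral of a Hopf algebra. -/
def IsLeftIntegral (K : Type*) {H : Type*} [Field K] [Ring H] [HopfAlgebra K H] (l : H) : Prop :=
  ∀ g : H, g * l = counit (R := K) g • l

namespace IsLeftIntegral

variable {l : H}

theorem comul_mul (hl : IsLeftIntegral K l) (g : H) :
    comul (R := K) g * comul l = counit (R := K) g • comul (R := K) l := by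
  rw [← Bialgebra.comul_mul, hl g, map_smul]

/-- In Sweedler notation, `1 ⊗ h = ∑ S(h₁)h₂ ⊗ h₃ = ∑ (S(h₁) ⊗ 1) Δ(h₂)`, and `Δ(h₂) Δ(l) = ε(h₂)
Δ(l)`. -/
theorem one_tmul_mul (hl : IsLeftIntegral K l) (h : H) :
    (1 ⊗ₜ[K] h) * comul (R := K) l = (antipode K h ⊗ₜ[K] 1) * comul (R := K) l := by
  let F : H ⊗[K] (H ⊗[K] H) →ₗ[K] H ⊗[K] H :=
    LinearMap.mulRight K (comul (R := K) l) ∘ₗ LinearMap.mul' K (H ⊗[K] H) ∘ₗ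
      TensorProduct.map ((Algebra.TensorProduct.includeLeft (R := K) (S := K) (A := H)
        (B := H)).toLinearMap ∘ₗ antipode K) LinearMap.id
  have hF (a : H) (t : H ⊗[K] H) : F (a ⊗ₜ t) = (antipode K a ⊗ₜ 1) * t * comul (R := K) l := by
    simp [F]
  have hF' (t : H ⊗[K] H) (c : H) : F (TensorProduct.assoc K H H H (t ⊗ₜ c)) =
      (LinearMap.mul' K H ((antipode K).rTensor H t) ⊗ₜ c) * comul (R := K) l := by
    induction t with
    | zero => simp
    | tmul x y => simp [hF]
    | add x y hx hy => simp only [map_add, add_tmul, add_mul, hx, hy]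
  have key := sum_assoc_comul_tmul (ℛ K h) F
  simp only [hF, hF', mul_antipode_rTensor_comul_apply, mul_assoc, hl.comul_mul] at key
  rw [← Finset.sum_mul] at key
  simp only [mul_smul_comm, ← smul_mul_assoc, ← Finset.sum_mul] at key
  have h1 : ∑ i ∈ (ℛ K h).index, (algebraMap K H (counit ((ℛ K h).left i))) ⊗ₜ[K] (ℛ K h).right i =
      1 ⊗ₜ h := by
    conv_rhs => rw [← sum_counit_smul (ℛ K h)]
    simp only [Algebra.algebraMap_eq_smul_one, tmul_sum, smul_tmul]
  have h2 : ∑ i ∈ (ℛ K h).index, counit (R := K) ((ℛ K h).right i) •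
      (antipode K ((ℛ K h).left i) ⊗ₜ[K] (1 : H)) = antipode K h ⊗ₜ 1 := by
    conv_rhs => rw [← sum_counit_right_smul (ℛ K h)]
    simp only [map_sum, map_smul, sum_tmul, smul_tmul']
  rwa [h1, h2] at key

/-- Evaluate `∑ (id ⊗ S)(Δ(g₁) Δ(l)) (1 ⊗ g₂)` in two ways: by `Δ(g₁) Δ(l) = ε(g₁) Δ(l)`, and by
antimultiplicativity of `S` followed by `S(g₂) g₃ = ε(g₂)`. -/
theorem tmul_one_mul (hl : IsLeftIntegral K l) (g : H) :
    (g ⊗ₜ[K] 1) * (antipode K).lTensor H (comul (R := K) l) =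
      (antipode K).lTensor H (comul (R := K) l) * (1 ⊗ₜ[K] g) := by
  let F₀ : (H ⊗[K] H) ⊗[K] H →ₗ[K] H ⊗[K] H :=
    LinearMap.mul' K (H ⊗[K] H) ∘ₗ
      TensorProduct.map ((antipode K).lTensor H ∘ₗ LinearMap.mulRight K (comul (R := K) l))
        (Algebra.TensorProduct.includeRight (R := K) (A := H) (B := H)).toLinearMap
  let F : H ⊗[K] (H ⊗[K] H) →ₗ[K] H ⊗[K] H :=
    F₀ ∘ₗ (TensorProduct.assoc K H H H).symm.toLinearMap
  have hF' (t : H ⊗[K] H) (c : H) : F (TensorProduct.assoc K H H H (t ⊗ₜ c)) =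
      (antipode K).lTensor H (t * comul (R := K) l) * (1 ⊗ₜ c) := by
    simp [F, F₀]
  have hm (a b : H) (d : H ⊗[K] H) : (antipode K).lTensor H ((a ⊗ₜ b) * d) =
      (a ⊗ₜ 1) * (antipode K).lTensor H d * (1 ⊗ₜ antipode K b) := by
    induction d with
    | zero => simp
    | tmul x y => simp [antipode_mul_antidistrib]
    | add x y hx hy => simp only [mul_add, map_add, add_mul, hx, hy]
  have hF (a : H) (t : H ⊗[K] H) : F (a ⊗ₜ t) =
      (a ⊗ₜ 1) * (antipode K).lTensor H (comul (R := K) l) *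
        (1 ⊗ₜ LinearMap.mul' K H ((antipode K).rTensor H t)) := by
    induction t with
    | zero => simp
    | tmul x y =>
      have := hF' (a ⊗ₜ x) y
      rw [TensorProduct.assoc_tmul] at this
      rw [this, hm, mul_assoc]
      simp
    | add x y hx hy => simp only [map_add, tmul_add, mul_add, hx, hy]
  have key := sum_assoc_comul_tmul (ℛ K g) F
  simp only [hF, hF', mul_antipode_rTensor_comul_apply, hl.comul_mul, map_smul] at key
  have h1 : ∑ i ∈ (ℛ K g).index, counit (R := K) ((ℛ K g).left i) •
      (antipode K).lTensor H (comul (R := K) l) * (1 ⊗ₜ (ℛ K g).right i) =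
        (antipode K).lTensor H (comul (R := K) l) * (1 ⊗ₜ g) := by
    conv_rhs => rw [← sum_counit_smul (ℛ K g)]
    simp only [tmul_sum, Finset.mul_sum, smul_mul_assoc, tmul_smul, mul_smul_comm]
  have h2 : ∑ i ∈ (ℛ K g).index, ((ℛ K g).left i ⊗ₜ[K] 1) *
      (antipode K).lTensor H (comul (R := K) l) *
        (1 ⊗ₜ algebraMap K H (counit ((ℛ K g).right i))) =
      (g ⊗ₜ[K] 1) * (antipode K).lTensor H (comul (R := K) l) := by
    conv_rhs => rw [← sum_counit_right_smul (ℛ K g)]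
    simp only [sum_tmul, Finset.sum_mul, Algebra.algebraMap_eq_smul_one, tmul_smul, mul_smul_comm,
      ← Algebra.TensorProduct.one_def, mul_one, ← smul_mul_assoc, smul_tmul']
  rw [h1, h2] at key
  exact key.symm

variable [FiniteDimensional K H]

/-- The hypothesis says `∑ f(S(l₂)) l₁ = 0`; `tmul_one_mul` improves it to `∑ f(S(l₂) g) l₁ = 0` for
all `g`, hence `∑ f(S(l₂) u(l₁)) = 0` for every linear `u`. Taking `u(x) = ∑ k(x₁) S²(x₂)` gives `∑
k(l₁) f(S(S(l₂) l₃)) = k(l) f(1)`, so `f(1) l = 0`. -/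
theorem apply_one_eq_zero (hl : IsLeftIntegral K l) (hl0 : l ≠ 0) {f : Module.Dual K H}
    (hf : evalSnd f ((antipode K).lTensor H (comul (R := K) l)) = 0) : f 1 = 0 := by
  have hg (g : H) : evalSnd (f ∘ₗ LinearMap.mulRight K g)
      ((antipode K).lTensor H (comul (R := K) l)) = 0 := by
    rw [← evalSnd_mul_one_tmul, ← hl.tmul_one_mul, evalSnd_tmul_one_mul, hf, mul_zero]
  have hu (u : H →ₗ[K] H) :
      ∑ i ∈ (ℛ K l).index, f (antipode K ((ℛ K l).right i) * u ((ℛ K l).left i)) = 0 := by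
    let b := Module.finBasis K H
    -- Expanding `x` in a basis replaces the variable element `u x` by the fixed elements `u (b j)`,
    -- to which `hg` applies.
    have h1 (x y : H) : f (antipode K y * u x) = ∑ j, b.coord j
        (evalSnd (f ∘ₗ LinearMap.mulRight K (u (b j))) ((antipode K).lTensor H (x ⊗ₜ[K] y))) := by
      have h2 : u x = ∑ j, b.repr x j • u (b j) := by
        simp only [← map_smul, ← map_sum, b.sum_repr]
      rw [h2]
      simp [Finset.mul_sum, mul_comm]
    simp only [h1]
    rw [Finset.sum_comm]
    refine Finset.sum_eq_zero fun j _ => ?_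
    rw [← map_sum, ← map_sum, ← map_sum, (ℛ K l).eq, hg, map_zero]
  let F : H ⊗[K] (H ⊗[K] H) →ₗ[K] H :=
    evalSnd (f ∘ₗ antipode K) ∘ₗ
      (LinearMap.mul' K H ∘ₗ (antipode K).rTensor H).lTensor H
  have hF (a : H) (t : H ⊗[K] H) : F (a ⊗ₜ t) =
      f (antipode K (LinearMap.mul' K H ((antipode K).rTensor H t))) • a := by
    simp [F]
  have hF' (k : Module.Dual K H) (t : H ⊗[K] H) (c : H) :
      k (F (TensorProduct.assoc K H H H (t ⊗ₜ c))) = f (antipode K c *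
        TensorProduct.lid K H (TensorProduct.map k (antipode K ∘ₗ antipode K) t)) := by
    induction t with
    | zero => simp
    | tmul x y => simp [hF, antipode_mul_antidistrib, mul_comm]
    | add x y hx hy => simp only [map_add, add_tmul, mul_add, hx, hy]
  have key := sum_assoc_comul_tmul (ℛ K l) F
  have h0 : ∑ i ∈ (ℛ K l).index,
      F (TensorProduct.assoc K H H H (comul ((ℛ K l).left i) ⊗ₜ (ℛ K l).right i)) = 0 := by
    refine (Module.forall_dual_apply_eq_zero_iff K _).mp fun k => ?_
    rw [map_sum]
    simp only [hF']
    exact hu ((TensorProduct.lid K H).toLinearMap ∘ₗ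
      TensorProduct.map k (antipode K ∘ₗ antipode K) ∘ₗ comul)
  have h1 : ∑ i ∈ (ℛ K l).index, F ((ℛ K l).left i ⊗ₜ comul ((ℛ K l).right i)) = f 1 • l := by
    conv_rhs => rw [← sum_counit_right_smul (ℛ K l)]
    simp only [hF, mul_antipode_rTensor_comul_apply, Algebra.algebraMap_eq_smul_one, map_smul,
      antipode_one, Finset.smul_sum, smul_smul, smul_eq_mul, mul_comm]
  rw [h0, h1] at key
  exact (smul_eq_zero.mp key.symm).resolve_right hl0

theorem eq_zero_of_evalSnd_antipode (hl : IsLeftIntegral K l) (hl0 : l ≠ 0) {f : Module.Dual K H}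
    (hf : evalSnd f ((antipode K).lTensor H (comul (R := K) l)) = 0) : f = 0 := by
  ext g
  have := hl.apply_one_eq_zero hl0 (f := f ∘ₗ LinearMap.mulRight K g) (by
    rw [← evalSnd_mul_one_tmul, ← hl.tmul_one_mul, evalSnd_tmul_one_mul, hf, mul_zero])
  simpa using this

/-- A functional vanishing on the image of the antipode satisfies the hypothesis of
`eq_zero_of_evalSnd_antipode`, so the antipode is onto; finite dimension does the rest. -/
theorem antipode_bijective (hl : IsLeftIntegral K l) (hl0 : l ≠ 0) :
    Function.Bijective (antipode K (A := H)) := by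
  have hs : Function.Surjective (antipode K (A := H)) := by
    rw [← LinearMap.dualMap_injective_iff, ← LinearMap.ker_eq_bot, eq_bot_iff]
    intro f hf
    refine hl.eq_zero_of_evalSnd_antipode hl0 ?_
    have h1 : f ∘ₗ antipode K = 0 := hf
    rw [evalSnd_lTensor, h1]
    simp [evalSnd]
  exact ⟨LinearMap.injective_iff_surjective.mpr hs, hs⟩

theorem eq_zero_of_evalSnd (hl : IsLeftIntegral K l) (hl0 : l ≠ 0) {f : Module.Dual K H}
    (hf : evalSnd f (comul (R := K) l) = 0) : f = 0 := by
  let S := LinearEquiv.ofBijective (antipode K (A := H)) (hl.antipode_bijective hl0)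
  have h1 : f = (f ∘ₗ S.symm.toLinearMap) ∘ₗ antipode K := by
    ext x
    simp only [LinearMap.comp_apply, LinearEquiv.coe_coe]
    exact congrArg f (S.symm_apply_apply x).symm
  rw [h1, ← evalSnd_lTensor] at hf
  rw [h1, hl.eq_zero_of_evalSnd_antipode hl0 hf, LinearMap.zero_comp]

/-- A finite-dimensional Hopf algebra with a nonzero left integral is Frobenius. -/
theorem isFrobeniusAlgebra (hl : IsLeftIntegral K l) (hl0 : l ≠ 0) : IsFrobeniusAlgebra K H := by
  let ψ : Module.Dual K H →ₗ[K] H :=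
    { toFun := fun f => evalSnd f (comul l)
      map_add' := fun f g => by simp [evalSnd, LinearMap.lTensor_add]
      map_smul' := fun c f => by simp [evalSnd, LinearMap.lTensor_smul] }
  have hψ : Function.Injective ψ :=
    LinearMap.ker_eq_bot.mp (eq_bot_iff.mpr fun f hf => hl.eq_zero_of_evalSnd hl0 hf)
  have hψs : Function.Surjective ψ :=
    (LinearMap.injective_iff_surjective_of_finrank_eq_finrank
      Subspace.dual_finrank_eq).mp hψ
  -- This `f`, with `∑ f(l₂) l₁ = 1`, is the Frobenius form: if `f (h * x) = 0` for all `x`, then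
  -- `one_tmul_mul` gives `S(h) = ∑ f(h l₂) l₁ = 0`.
  obtain ⟨f, hf⟩ := hψs 1
  have hf1 : evalSnd f (comul (R := K) l) = 1 := hf
  have hleft (h : H) (hh : ∀ x, f (h * x) = 0) : h = 0 := by
    have h1 : f ∘ₗ LinearMap.mulLeft K h = 0 := LinearMap.ext hh
    have h2 := congrArg (evalSnd f) (hl.one_tmul_mul h)
    rw [evalSnd_one_tmul_mul, evalSnd_tmul_one_mul, h1, hf1, mul_one] at h2
    refine (hl.antipode_bijective hl0).1 ?_
    rw [map_zero, ← h2]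
    simp [evalSnd]
  let Φ : H →ₗ[K] Module.Dual K H := (LinearMap.mul K H).compr₂ f
  have hΦ : Function.Surjective Φ := by
    refine (LinearMap.injective_iff_surjective_of_finrank_eq_finrank
      Subspace.dual_finrank_eq.symm).mp (LinearMap.ker_eq_bot.mp (eq_bot_iff.mpr fun h hh => ?_))
    exact hleft h fun x => LinearMap.congr_fun hh x
  let Θ : H →ₗ[K] Module.Dual K H := ((LinearMap.mul K H).compr₂ f).flip
  have hΘ : Function.Injective Θ := by
    refine LinearMap.ker_eq_bot.mp (eq_bot_iff.mpr fun a ha => ?_)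
    refine (Module.forall_dual_apply_eq_zero_iff K a).mp fun g => ?_
    obtain ⟨h, rfl⟩ := hΦ g
    exact LinearMap.congr_fun ha h
  refine ⟨LinearEquiv.ofBijective Θ ⟨hΘ, (LinearMap.injective_iff_surjective_of_finrank_eq_finrank
      Subspace.dual_finrank_eq.symm).mp hΘ⟩, fun a b x => ?_⟩
  change f (x * (a * b)) = f (x * a * b)
  rw [mul_assoc]

end IsLeftIntegral

/-- A common eigenvector of all left multiplications can be twisted into a left integral. -/
theorem exists_isLeftIntegral [FiniteDimensional K H] {p : H} (hp : p ≠ 0) (χ : H →ₐ[K] K)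
    (hχ : ∀ h, h * p = χ h • p) : ∃ l : H, l ≠ 0 ∧ IsLeftIntegral K l := by
  let E : H ⊗[K] H →ₗ[K] H := (TensorProduct.lid K H).toLinearMap ∘ₗ χ.toLinearMap.rTensor H
  -- The twist `T(h) = ∑ χ(h₁) h₂` is an algebra map with `ε ∘ T = χ`. It is inverted by `h ↦ ∑
  -- χ(S(h₁)) h₂`, so `T p` is a nonzero left integral.
  let T : H →ₐ[K] H := (Algebra.TensorProduct.lid K H).toAlgHom.comp
    ((Algebra.TensorProduct.map χ (AlgHom.id K H)).comp (Bialgebra.comulAlgHom K H))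
  have hT (h : H) : T h = E (comul h) := rfl
  let F : H ⊗[K] (H ⊗[K] H) →ₗ[K] H :=
    (TensorProduct.lid K H).toLinearMap ∘ₗ TensorProduct.map (χ.toLinearMap ∘ₗ antipode K) E
  have hF (a : H) (t : H ⊗[K] H) : F (a ⊗ₜ t) = χ (antipode K a) • E t := by simp [F]
  have hF' (t : H ⊗[K] H) (c : H) : F (TensorProduct.assoc K H H H (t ⊗ₜ c)) =
      χ (LinearMap.mul' K H ((antipode K).rTensor H t)) • c := by
    induction t with
    | zero => simp
    | tmul x y => simp [hF, E, smul_smul]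
    | add x y hx hy => simp only [map_add, add_tmul, add_smul, hx, hy]
  have hsurj : Function.Surjective T.toLinearMap := by
    intro h
    refine ⟨∑ i ∈ (ℛ K h).index, χ (antipode K ((ℛ K h).left i)) • (ℛ K h).right i, ?_⟩
    have key := sum_assoc_comul_tmul (ℛ K h) F
    simp only [hF, hF', mul_antipode_rTensor_comul_apply, AlgHom.commutes, Algebra.algebraMap_self,
      RingHom.id_apply] at key
    rw [sum_counit_smul] at key
    simp only [AlgHom.toLinearMap_apply, map_sum, map_smul, hT]
    exact key.symm
  have hinj : Function.Injective T.toLinearMap := LinearMap.injective_iff_surjective.mpr hsurj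
  have hcounit (h : H) : counit (R := K) (T h) = χ h := by
    have h1 (t : H ⊗[K] H) : counit (R := K) (E t) = χ (TensorProduct.rid K H
        (counit.lTensor H t)) := by
      induction t with
      | zero => simp
      | tmul x y => simp [E, mul_comm]
      | add x y hx hy => simp only [map_add, hx, hy]
    rw [hT, h1, lTensor_counit_comul]
    simp
  refine ⟨T p, fun h => hp (hinj (h.trans (map_zero T).symm)), fun g => ?_⟩
  obtain ⟨h, rfl⟩ := hsurj g
  change T h * T p = counit (R := K) (T h) • T p
  rw [← map_mul, hχ, map_smul, hcounit]

/-- The radical kills a maximal path `m` from the left, so `H` acts on it by the character reading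
off the coefficient at the target of `m`. -/
theorem PathBasis.exists_isLeftIntegral {V ι : Type*} [Fintype V] (B : PathBasis K H V ι)
    [FiniteDimensional K H] : ∃ l : H, l ≠ 0 ∧ IsLeftIntegral K l := by
  have : Finite ι := Module.Finite.finite_basis B.b
  have hne : Nonempty ι := by
    by_contra h
    rw [not_nonempty_iff] at h
    have h1 : (1 : H) = 0 := by exact (B.b.ext_elem fun i => h.elim i)
    have h2 := congrArg (counit (R := K)) h1
    simp at h2
  obtain ⟨i⟩ := hne
  obtain ⟨m, hm, -⟩ := B.exists_maximal i
  refine _root_.exists_isLeftIntegral (B.b.ne_zero m)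
    ((Pi.evalAlgHom K (fun _ : V => K) (B.tgt m)).comp B.proj) fun h => ?_
  rw [B.mul_b_eq, add_mul, B.mul_eq_zero_of_maximal hm (B.sub_mem_fil h), add_zero,
    ← Algebra.smul_def]
  rfl

end HopfFrobenius

/-! ### Idempotents and radical generators of an elementary Nakayama algebra. -/

/-- Generators of an elementary algebra whose indecomposable projective left modules are uniserial:
a complete set of primitive orthogonal idempotents `e i`, and generators `x i` of the radicals of
the modules `A e_i`. -/
structure SerialGenerators (K A V : Type*) [Field K] [Ring A] [Algebra K A] [Fintype V]
    [DecidableEq V] [Quiver V] where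
  /-- the semisimple quotient -/
  proj : A →ₐ[K] (V → K)
  nilp : IsNilpotent (RingHom.ker proj)
  /-- the idempotents -/
  e : V → A
  proj_e : ∀ i, proj (e i) = Pi.single i 1
  complete : CompleteOrthogonalIdempotents e
  /-- the radical generators -/
  x : V → A
  /-- the vertex of the top of the radical -/
  next : V → V
  x_mem : ∀ i, x i ∈ RingHom.ker proj
  e_mul_x : ∀ i, e (next i) * x i = x i
  x_mul_e : ∀ i, x i * e i = x i
  exists_eq_mul : ∀ i, ∀ r ∈ RingHom.ker proj, ∃ a, r * e i = a * x i
  next_eq : ∀ {i j : V}, (i ⟶ j) → next i = j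
  x_ne_zero : ∀ {i j : V}, (i ⟶ j) → x i ≠ 0
  nonempty_hom : ∀ i, x i ≠ 0 → Nonempty (i ⟶ next i)
  subsingleton_hom : ∀ i j : V, Subsingleton (i ⟶ j)

section Construction

variable {K A V : Type*} [Field K] [Ring A] [Algebra K A]

theorem Ideal.isNilpotent_of_mem {I : Ideal A} (hI : IsNilpotent I) {r : A} (hr : r ∈ I) :
    IsNilpotent r := by
  obtain ⟨m, hm⟩ := hI
  refine ⟨m, ?_⟩
  have : ∀ k, r ^ k ∈ I ^ k := by
    intro k
    induction k with
    | zero =>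
      rw [Submodule.pow_zero, Submodule.one_eq_span]
      exact Submodule.mem_span_singleton.mpr ⟨_, mul_one _⟩
    | succ k ih =>
      rw [Submodule.pow_succ, pow_succ]
      exact Submodule.mul_mem_mul ih hr
  have h := this m
  rw [hm] at h
  exact h

theorem isUnit_algebraMap_add {Ψ : A →ₐ[K] (V → K)} (hΨ : IsNilpotent (RingHom.ker Ψ))
    {c : K} (hc : c ≠ 0) {r : A} (hr : r ∈ RingHom.ker Ψ) : IsUnit (algebraMap K A c + r) := by
  exact (Ideal.isNilpotent_of_mem hΨ hr).isUnit_add_left_of_commute ((IsUnit.mk0 _ hc).map _)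
    (Algebra.commutes _ _).symm

variable [DecidableEq V]

theorem mul_e_sub_mem_ker {Ψ : A →ₐ[K] (V → K)} {e : A} {i : V}
    (he : Ψ e = Pi.single i 1) (a : A) : a * e - Ψ a i • e ∈ RingHom.ker Ψ := by
  rw [RingHom.mem_ker, map_sub, map_mul, map_smul, he, sub_eq_zero]
  ext j
  by_cases h : j = i
  · subst h; simp
  · simp [h]

/-- An element `y` of `A e` with nonzero `i`-th coordinate is `u * e` for a unit `u`, hence
generates `A e`. In a decomposition the coordinates of the two components of `e` add up to `1`, so
one summand is everything. -/
theorem isIndecomposableModule_span {Ψ : A →ₐ[K] (V → K)}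
    (hΨ : IsNilpotent (RingHom.ker Ψ)) {e : A} {i : V} (hi : IsIdempotentElem e)
    (he : Ψ e = Pi.single i 1) : IsIndecomposableModule A (Submodule.span A {e}) := by
  have he0 : e ≠ 0 := by
    rintro rfl
    have := congr_fun he i
    simp at this
  have hmem : e ∈ Submodule.span A {e} := Submodule.mem_span_singleton_self e
  refine ⟨⟨⟨⟨e, hmem⟩, 0, fun h => he0 (congrArg Subtype.val h)⟩⟩, fun N N' hN => ?_⟩
  have key (N : Submodule A (Submodule.span A {e})) (y : Submodule.span A {e}) (hy : y ∈ N)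
      (hc : Ψ y.1 i ≠ 0) : N = ⊤ := by
    have hye : y.1 * e = y.1 := by
      obtain ⟨a, ha⟩ := Submodule.mem_span_singleton.mp y.2
      rw [← ha, smul_eq_mul, mul_assoc, hi.eq]
    obtain ⟨u, hu⟩ := isUnit_algebraMap_add hΨ hc (mul_e_sub_mem_ker he y.1)
    have h1 : u * e = y.1 := by
      rw [hu, add_mul, sub_mul, mul_assoc, smul_mul_assoc, hi.eq, ← Algebra.smul_def,
        add_sub_cancel, hye]
    have h2 : (⟨e, hmem⟩ : Submodule.span A {e}) ∈ N := by
      have h3 : (⟨e, hmem⟩ : Submodule.span A {e}) = (u⁻¹ : Aˣ).1 • y := by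
        ext
        rw [Submodule.coe_smul, smul_eq_mul, ← h1, Units.inv_mul_cancel_left]
      rw [h3]
      exact N.smul_mem _ hy
    refine eq_top_iff.mpr ?_
    rintro ⟨z, hz⟩ -
    obtain ⟨a, rfl⟩ := Submodule.mem_span_singleton.mp hz
    exact N.smul_mem a h2
  have htop : (⟨e, hmem⟩ : Submodule.span A {e}) ∈ N ⊔ N' := by
    rw [hN.sup_eq_top]; exact Submodule.mem_top
  obtain ⟨y, hy, y', hy', h⟩ := Submodule.mem_sup.mp htop
  have h1 : Ψ y.1 i + Ψ y'.1 i = 1 := by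
    have h2 : y.1 + y'.1 = e := congrArg Subtype.val h
    rw [← Pi.add_apply, ← map_add, h2, he, Pi.single_eq_same]
  by_cases hc : Ψ y.1 i = 0
  · have h2 := key N' y' hy' (by rw [hc, zero_add] at h1; rw [h1]; exact one_ne_zero)
    left
    simpa [h2] using hN.inf_eq_bot
  · have h2 := key N y hy hc
    right
    simpa [h2] using hN.inf_eq_bot

/-- The radical of a uniserial `A e` is generated by some `e j * r * e`. -/
theorem exists_radical_generator [IsNoetherianRing A] {n : ℕ} {R : Ideal A} {e : Fin n → A}
    (hsum : ∑ j, e j = 1) (i : Fin n)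
    (ht : ∀ N N' : Submodule A (Submodule.span A {e i}), N ≤ N' ∨ N' ≤ N) :
    ∃ j, ∃ r ∈ R, ∀ s ∈ R, ∃ a, s * e i = a * (e j * r * e i) := by
  have ht' (a b : A) : (∃ c, a * e i = c * (b * e i)) ∨ (∃ c, b * e i = c * (a * e i)) := by
    have hm (a : A) : a * e i ∈ Submodule.span A {e i} := Submodule.mem_span_singleton.mpr ⟨a, rfl⟩
    rcases ht (Submodule.span A {⟨a * e i, hm a⟩}) (Submodule.span A {⟨b * e i, hm b⟩}) with h | h
    · left
      obtain ⟨c, hc⟩ := Submodule.mem_span_singleton.mp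
        ((Submodule.span_singleton_le_iff_mem _ _).mp h)
      exact ⟨c, (congrArg Subtype.val hc).symm⟩
    · right
      obtain ⟨c, hc⟩ := Submodule.mem_span_singleton.mp
        ((Submodule.span_singleton_le_iff_mem _ _).mp h)
      exact ⟨c, (congrArg Subtype.val hc).symm⟩
  let Z : Set (Ideal A) := {N | ∃ j, ∃ r ∈ R, N = Submodule.span A {e j * r * e i}}
  -- A maximal left ideal among the `A (e j * r * e i)`, which exists by noetherianity. By totality
  -- it contains all the others, hence all of `R e_i`.
  obtain ⟨N, ⟨j, r, hr, rfl⟩, hN⟩ := WellFounded.has_min (wellFounded_gt (α := Ideal A)) Z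
    ⟨_, i, 0, R.zero_mem, rfl⟩
  refine ⟨j, r, hr, fun s hs => ?_⟩
  have hk (k : Fin n) : e k * s * e i ∈ Submodule.span A {e j * r * e i} := by
    rcases ht' (e k * s) (e j * r) with ⟨c, hc⟩ | ⟨c, hc⟩
    · exact Submodule.mem_span_singleton.mpr ⟨c, hc.symm⟩
    · by_contra hcon
      refine hN _ ⟨k, s, hs, rfl⟩ (lt_of_le_of_ne ?_ ?_)
      · exact (Submodule.span_singleton_le_iff_mem _ _).mpr
          (Submodule.mem_span_singleton.mpr ⟨c, hc.symm⟩)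
      · intro heq
        exact hcon (heq ▸ Submodule.mem_span_singleton_self _)
  have h1 : s * e i ∈ Submodule.span A {e j * r * e i} := by
    have : s * e i = ∑ k, e k * s * e i := by rw [← Finset.sum_mul, ← Finset.sum_mul, hsum, one_mul]
    rw [this]
    exact Submodule.sum_mem _ fun k _ => hk k
  obtain ⟨a, ha⟩ := Submodule.mem_span_singleton.mp h1
  exact ⟨a, ha.symm⟩

theorem IsElementaryAlgebra.exists_serialGenerators {K : Type*} {A : Type*} [Field K] [Ring A]
    [Algebra K A] [FiniteDimensional K A] (h : IsElementaryAlgebra K A) (hN : IsNakayamaAlgebra A) :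
    ∃ (n : ℕ) (_ : Quiver.{0} (Fin n)), Nonempty (SerialGenerators K A (Fin n)) := by
  have : IsNoetherianRing A := isNoetherian_of_tower K inferInstance
  have : IsArtinianRing A := isArtinian_of_tower K inferInstance
  obtain ⟨n, ⟨g⟩⟩ := h
  let Ψ : A →ₐ[K] (Fin n → K) := (g : _ →ₐ[K] _).comp (Ideal.Quotient.mkₐ K (Ring.jacobson A))
  have hs : Function.Surjective Ψ := g.surjective.comp Ideal.Quotient.mk_surjective
  have hker : RingHom.ker Ψ = Ring.jacobson A := by
    ext x
    rw [RingHom.mem_ker, ← Ideal.Quotient.eq_zero_iff_mem]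
    exact g.map_eq_zero_iff
  have hnil : IsNilpotent (RingHom.ker Ψ) := hker ▸ IsSemiprimaryRing.isNilpotent
  obtain ⟨e, he, hΨe⟩ := CompleteOrthogonalIdempotents.lift_of_isNilpotent_ker
    (Ψ : A →+* (Fin n → K)) (fun r => Ideal.isNilpotent_of_mem hnil)
    (CompleteOrthogonalIdempotents.single fun _ : Fin n => K) fun i => hs _
  have hΨe' (i) : Ψ (e i) = Pi.single i 1 := congr_fun hΨe i
  have ht (i) := (hN.1 (Submodule.span A {e i}) (he.idem i).projective_span
    (isIndecomposableModule_span hnil (he.idem i) (hΨe' i))).total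
  choose j r hr hj using fun i =>
    exists_radical_generator (R := RingHom.ker Ψ) he.complete i (ht i)
  -- One arrow from `k` to `j k` when the radical generator at `k` is nonzero, and no other arrows.
  let q : Quiver.{0} (Fin n) := ⟨fun k l => PLift (e (j k) * r k * e k ≠ 0 ∧ j k = l)⟩
  exact ⟨n, q, ⟨{
    proj := Ψ
    nilp := hnil
    e := e
    proj_e := hΨe'
    complete := he
    x := fun i => e (j i) * r i * e i
    next := j
    x_mem := fun i => by
      have := (RingHom.mem_ker).mp (hr i)
      rw [RingHom.mem_ker, map_mul, map_mul, this, mul_zero, zero_mul]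
    e_mul_x := fun i => by rw [← mul_assoc, ← mul_assoc, (he.idem _).eq]
    x_mul_e := fun i => by rw [mul_assoc, (he.idem _).eq]
    exists_eq_mul := hj
    next_eq := fun f => f.down.2
    x_ne_zero := fun f => f.down.1
    nonempty_hom := fun i hi => ⟨⟨hi, rfl⟩⟩
    subsingleton_hom := fun i j => inferInstanceAs (Subsingleton (PLift _)) }⟩⟩

end Construction

/-! ### The monomial presentation built from these generators. -/

namespace SerialGenerators

variable {K A V : Type*} [Field K] [Ring A] [Algebra K A] [Fintype V] [DecidableEq V] [Quiver V]
  (D : SerialGenerators K A V)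

/-- The element of the algebra represented by a path. -/
def pathVal {a : V} : ∀ {b : V}, Quiver.Path a b → A
  | _, .nil => D.e a
  | _, .cons (b := b) p _ => D.x b * pathVal p

theorem pathVal_nil (a : V) : D.pathVal (.nil : Quiver.Path a a) = D.e a := rfl

theorem pathVal_cons {a b c : V} (p : Quiver.Path a b) (f : b ⟶ c) :
    D.pathVal (p.cons f) = D.x b * D.pathVal p := rfl

theorem pathVal_mul_e {a b : V} (p : Quiver.Path a b) :
    D.pathVal p * D.e a = D.pathVal p := by
  induction p with
  | nil => exact (D.complete.idem a).eq
  | cons p f ih => rw [pathVal_cons, mul_assoc, ih]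

theorem e_mul_pathVal {a b : V} (p : Quiver.Path a b) :
    D.e b * D.pathVal p = D.pathVal p := by
  cases p with
  | nil => exact (D.complete.idem a).eq
  | cons p f => rw [pathVal_cons, ← mul_assoc, ← D.next_eq f, D.e_mul_x]

theorem pathVal_comp {a b c : V} (p : Quiver.Path a b) (q : Quiver.Path b c) :
    D.pathVal (p.comp q) = D.pathVal q * D.pathVal p := by
  induction q with
  | nil => rw [Quiver.Path.comp_nil, pathVal_nil, e_mul_pathVal]
  | cons q f ih => rw [Quiver.Path.comp_cons, pathVal_cons, pathVal_cons, ih, mul_assoc]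

theorem pathVal_mem_ker {a b : V} (p : Quiver.Path a b) (hp : 0 < p.length) :
    D.pathVal p ∈ RingHom.ker D.proj := by
  cases p with
  | nil => simp at hp
  | cons p f =>
    rw [pathVal_cons, RingHom.mem_ker, map_mul, RingHom.mem_ker.mp (D.x_mem _), zero_mul]

/-- Each vertex has at most one outgoing arrow, so source and length determine a path. -/
theorem path_unique (D : SerialGenerators K A V) {a b b' : V} (p : Quiver.Path a b)
    (p' : Quiver.Path a b') (h : p.length = p'.length) : QuiverPath.mk a b p = QuiverPath.mk a b' p' := by
  induction p generalizing b' with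
  | nil =>
    cases p' with
    | nil => rfl
    | cons p' f' => simp at h
  | cons p f ih =>
    cases p' with
    | nil => simp at h
    | cons p' f' =>
      have h1 := ih p' (by simpa using h)
      injection h1 with _ h2 h3
      subst h2
      have h4 := (D.next_eq f).symm.trans (D.next_eq f')
      subst h4
      rw [eq_of_heq h3, (D.subsingleton_hom _ _).elim f f']

open PathAlgebra

/-- The algebra homomorphism from the path algebra. -/
noncomputable def toAlgHom : PathAlgebra K V →ₐ[K] A := by
  refine AlgHom.ofLinearMap
    ((pathsBasis K V).constr K fun p => D.pathVal p.path) ?_ ?_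
  · rw [one_def, map_sum, ← D.complete.complete]
    refine Finset.sum_congr rfl fun v _ => ?_
    rw [← pathsBasis_apply, (pathsBasis K V).constr_basis K]
    rfl
  · intro x y
    induction x using PathAlgebra.induction with
    | h0 => rw [zero_mul, map_zero, zero_mul]
    | hadd x x' hx hx' => rw [add_mul, map_add, map_add, hx, hx', add_mul]
    | hs c q =>
      rw [smul_mul_assoc, map_smul, map_smul, smul_mul_assoc]
      congr 1
      induction y using PathAlgebra.induction with
      | h0 => rw [mul_zero, map_zero, mul_zero]
      | hadd y y' hy hy' => rw [mul_add, map_add, map_add, hy, hy', mul_add]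
      | hs c p =>
        rw [mul_smul_comm, map_smul, map_smul, mul_smul_comm]
        congr 1
        obtain ⟨b', c, q⟩ := q
        obtain ⟨a, b, p⟩ := p
        by_cases h : b = b'
        · subst h
          rw [ofPath_mul_of_eq, ← pathsBasis_apply, ← pathsBasis_apply, ← pathsBasis_apply,
            (pathsBasis K V).constr_basis K, (pathsBasis K V).constr_basis K,
            (pathsBasis K V).constr_basis K, pathVal_comp]
        · rw [ofPath_mul_of_ne K h, map_zero, ← pathsBasis_apply, ← pathsBasis_apply,
            (pathsBasis K V).constr_basis K, (pathsBasis K V).constr_basis K, ← D.pathVal_mul_e q,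
            ← D.e_mul_pathVal p, mul_assoc, ← mul_assoc (D.e b'),
            D.complete.ortho (Ne.symm h), zero_mul, mul_zero]

theorem toAlgHom_ofPath (p : QuiverPath V) : D.toAlgHom (ofPath K p) = D.pathVal p.path := by
  rw [← pathsBasis_apply]
  exact (pathsBasis K V).constr_basis K _ _

theorem eq_zero_of_mul_eq {y r : A} {c : K} (hc : c ≠ 0) (hr : r ∈ RingHom.ker D.proj)
    (h : c • y + r * y = 0) : y = 0 := by
  obtain ⟨u, hu⟩ := isUnit_algebraMap_add D.nilp hc hr
  rw [Algebra.smul_def, ← add_mul, ← hu] at h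
  exact (Units.mul_right_eq_zero u).mp h

/-- Suppose `z` involves a path with nonzero value, and let `q` be a shortest such path with that
source. After right multiplication by the idempotent at this source, every other term vanishes or
comes from a proper extension of `q`, so it is a radical multiple of the value of `q`. The relation
then reads (nonzero scalar + radical) times that value equals zero, and the first factor is a unit.
-/
theorem mem_pathSpan_of_toAlgHom_eq_zero {z : PathAlgebra K V} (hz : D.toAlgHom z = 0) :
    z ∈ pathSpan K {p | D.pathVal p.path = 0} := by
  classical
  rw [mem_pathSpan]
  intro p₀ hp₀
  change D.pathVal p₀.path = 0
  by_contra hne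
  let b := pathsBasis K V
  have hfin : {q | q ∈ (b.repr z).support ∧ q.src = p₀.src ∧ D.pathVal q.path ≠ 0}.Finite :=
    (b.repr z).support.finite_toSet.subset fun q hq => hq.1
  obtain ⟨q, ⟨hq1, hq2, hq3⟩, hmin⟩ := hfin.exists_minimalFor (fun q => q.path.length) _
    ⟨p₀, Finsupp.mem_support_iff.mpr hp₀, rfl, hne⟩
  have key (q' : QuiverPath V) (hq' : q' ∈ (b.repr z).support.erase q) :
      ∃ r ∈ RingHom.ker D.proj, D.pathVal q'.path * D.e q.src = r * D.pathVal q.path := by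
    rw [Finset.mem_erase] at hq'
    obtain ⟨a, c, q⟩ := q
    obtain ⟨a', c', q'⟩ := q'
    by_cases ha : a' = a
    · subst ha
      by_cases h0 : D.pathVal q' = 0
      · exact ⟨0, Ideal.zero_mem _, by rw [h0, zero_mul, zero_mul]⟩
      · have hle : q.length ≤ q'.length := by
          by_contra hlt
          have := hmin (j := ⟨a', c', q'⟩) ⟨hq'.2, hq2, h0⟩ (not_le.mp hlt).le
          exact hlt this
        obtain ⟨d, q₁, q₂, rfl, hl⟩ := q'.exists_eq_comp_of_le_length hle
        have h1 := D.path_unique q₁ q hl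
        injection h1 with _ h2 h3
        subst h2
        obtain rfl := eq_of_heq h3
        refine ⟨D.pathVal q₂, D.pathVal_mem_ker q₂ ?_, ?_⟩
        · rw [Nat.pos_iff_ne_zero]
          intro h
          exact hq'.1 (D.path_unique _ _ (by rw [Quiver.Path.length_comp, h, add_zero]))
        · rw [pathVal_mul_e, pathVal_comp]
    · refine ⟨0, Ideal.zero_mem _, ?_⟩
      change D.pathVal q' * D.e a = _
      rw [← pathVal_mul_e, mul_assoc, D.complete.ortho ha, mul_zero, zero_mul]
  choose! r hr hrq using key
  have hsum : D.toAlgHom z = ∑ q' ∈ (b.repr z).support, b.repr z q' • D.pathVal q'.path := by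
    conv_lhs => rw [← b.linearCombination_repr z, Finsupp.linearCombination_apply, Finsupp.sum]
    rw [map_sum]
    refine Finset.sum_congr rfl fun q' _ => ?_
    rw [map_smul, ← toAlgHom_ofPath, ← pathsBasis_apply]
  have h0 : D.toAlgHom z * D.e q.src = 0 := by rw [hz, zero_mul]
  rw [hsum, Finset.sum_mul, ← Finset.add_sum_erase _ _ hq1] at h0
  refine hq3 (D.eq_zero_of_mul_eq (c := b.repr z q)
    (r := ∑ q' ∈ (b.repr z).support.erase q, b.repr z q' • r q')
    (Finsupp.mem_support_iff.mp hq1) ?_ ?_)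
  · refine Ideal.sum_mem _ fun q' hq' => ?_
    exact Submodule.smul_of_tower_mem _ _ (hr q' hq')
  · rw [← h0, smul_mul_assoc, pathVal_mul_e, Finset.sum_mul]
    congr 1
    refine Finset.sum_congr rfl fun q' hq' => ?_
    rw [smul_mul_assoc, smul_mul_assoc, hrq q' hq']

theorem toAlgHom_mem_ker_pow (k : ℕ) {z : PathAlgebra K V}
    (hz : z ∈ (arrowIdeal K V).asIdeal ^ k) :
    D.toAlgHom z ∈ (RingHom.ker D.proj) ^ k := by
  have h1 : ∀ y ∈ (arrowIdeal K V).asIdeal, D.toAlgHom y ∈ RingHom.ker D.proj := by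
    intro y hy
    have h2 : arrowIdeal K V ≤ TwoSidedIdeal.ker (D.proj.comp D.toAlgHom) := by
      refine TwoSidedIdeal.span_le.mpr ?_
      rintro _ ⟨_, ⟨a, b, f, rfl⟩, rfl⟩
      refine (TwoSidedIdeal.mem_ker _).mpr ?_
      rw [AlgHom.comp_apply, toAlgHom_ofPath]
      exact D.pathVal_mem_ker _ Nat.one_pos
    exact (TwoSidedIdeal.mem_ker _).mp (h2 (TwoSidedIdeal.mem_asIdeal.mp hy))
  induction k generalizing z with
  | zero =>
    rw [Submodule.pow_zero, Submodule.one_eq_span]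
    exact Submodule.mem_span_singleton.mpr ⟨_, mul_one _⟩
  | succ k ih =>
    rw [Submodule.pow_succ] at hz ⊢
    refine Submodule.mul_induction_on hz (fun a ha c hc => ?_) fun a c ha hc => ?_
    · rw [map_mul]
      exact Submodule.mul_mem_mul (ih ha) (h1 c hc)
    · rw [map_add]
      exact Submodule.add_mem _ ha hc

/-- Descending induction on path length. Modulo `A * x j`, the element `a * e j` is a scalar
multiple of `e j`, so `a` times a path is a multiple of that path plus some `a'` times the path
extended by one arrow. Paths of length at least `m` have value zero because the radical is
nilpotent. -/
theorem toAlgHom_surjective : Function.Surjective D.toAlgHom := by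
  obtain ⟨m, hm⟩ := D.nilp
  have key : ∀ k : ℕ, ∀ {i j : V} (p : Quiver.Path i j), m ≤ p.length + k →
      ∀ a, ∃ z, D.toAlgHom z = a * D.pathVal p := by
    intro k
    induction k with
    | zero =>
      intro i j p hp a
      have h1 := D.toAlgHom_mem_ker_pow m (ofPath_mem_arrowIdeal_pow m (p := ⟨i, j, p⟩) hp)
      rw [hm, toAlgHom_ofPath] at h1
      have h2 : D.pathVal p = 0 := h1
      exact ⟨0, by rw [h2, mul_zero, map_zero]⟩
    | succ k ih =>
      intro i j p hp a
      obtain ⟨a', ha'⟩ := D.exists_eq_mul j _ (mul_e_sub_mem_ker (D.proj_e j) a)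
      have h1 : a * D.pathVal p = D.proj a j • D.pathVal p + a' * (D.x j * D.pathVal p) := by
        have h2 := congrArg (· * D.pathVal p) ha'
        simp only [sub_mul, mul_assoc, smul_mul_assoc, e_mul_pathVal] at h2
        rw [← h2, add_sub_cancel]
      rw [h1]
      by_cases hx : D.x j = 0
      · refine ⟨D.proj a j • ofPath K ⟨i, j, p⟩, ?_⟩
        rw [map_smul, toAlgHom_ofPath, hx, zero_mul, mul_zero, add_zero]
      · obtain ⟨f⟩ := D.nonempty_hom j hx
        obtain ⟨z, hz⟩ := ih (p.cons f) (by rw [Quiver.Path.length_cons]; omega) a'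
        refine ⟨D.proj a j • ofPath K ⟨i, j, p⟩ + z, ?_⟩
        rw [map_add, map_smul, toAlgHom_ofPath, hz, pathVal_cons]
  intro a
  choose z hz using fun i : V => key m (.nil : Quiver.Path i i) (by simp) a
  refine ⟨∑ i, z i, ?_⟩
  rw [map_sum]
  simp only [hz, pathVal_nil]
  rw [← Finset.mul_sum]
  rw [D.complete.complete, mul_one]

theorem two_le_length {p : QuiverPath V} (hp : D.pathVal p.path = 0) :
    2 ≤ p.path.length := by
  obtain ⟨a, b, p⟩ := p
  cases p with
  | nil =>
    have h := D.proj_e a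
    rw [show D.e a = 0 from hp, map_zero] at h
    have := congr_fun h a
    simp at this
  | cons p f =>
    cases p with
    | nil =>
      change D.x a * D.e a = 0 at hp
      rw [D.x_mul_e] at hp
      exact (D.x_ne_zero f hp).elim
    | cons p f' =>
      simp only [Quiver.Path.length_cons]
      omega

theorem isMonomialAlgebra {K A : Type*} [Field K] [Ring A] [Algebra K A] {V : Type} [Fintype V]
    [DecidableEq V] [Quiver.{0} V] (D : SerialGenerators K A V) : IsMonomialAlgebra K A := by
  let T : Set (QuiverPath V) := {p | D.pathVal p.path = 0}
  have hI (z) : z ∈ pathIdeal K T ↔ D.toAlgHom z = 0 := by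
    constructor
    · intro hz
      have h2 : pathIdeal K T ≤ TwoSidedIdeal.ker D.toAlgHom := by
        refine TwoSidedIdeal.span_le.mpr ?_
        rintro _ ⟨p, hp, rfl⟩
        exact (TwoSidedIdeal.mem_ker _).mpr ((D.toAlgHom_ofPath p).trans hp)
      exact (TwoSidedIdeal.mem_ker _).mp (h2 hz)
    · intro hz
      refine pathSpan_induction (P := fun z => z ∈ pathIdeal K T) (zero_mem _)
        (fun x y => add_mem) (fun c x hx => ?_) (fun p hp => ?_)
        (D.mem_pathSpan_of_toAlgHom_eq_zero hz)
      · rw [Algebra.smul_def]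
        exact TwoSidedIdeal.mul_mem_left _ _ _ hx
      · exact TwoSidedIdeal.subset_span ⟨p, hp, rfl⟩
  obtain ⟨m, hm⟩ := D.nilp
  -- The `m`-th power of the arrow ideal already maps to zero; adding `2` secures the bound `2 ≤ N`.
  refine ⟨V, inferInstance, inferInstance,
    fun a b => @Finite.of_subsingleton _ (D.subsingleton_hom a b), T,
    ⟨m + 2, by omega, ?_, ?_⟩, ⟨?_⟩⟩
  · intro z hz
    rw [TwoSidedIdeal.mem_asIdeal, hI]
    have h1 := D.toAlgHom_mem_ker_pow _ hz
    rw [Submodule.pow_succ, Submodule.pow_succ, hm] at h1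
    simpa using h1
  · intro z hz
    rw [TwoSidedIdeal.mem_asIdeal, hI] at hz
    refine pathSpan_induction (P := fun z => z ∈ (arrowIdeal K V).asIdeal ^ 2)
      (Submodule.zero_mem _) (fun x y => Submodule.add_mem _)
      (fun c x => Submodule.smul_of_tower_mem _ c) (fun p hp => ?_)
      (D.mem_pathSpan_of_toAlgHom_eq_zero hz)
    exact ofPath_mem_arrowIdeal_pow 2 (D.two_le_length hp)
  · refine (Ideal.quotientKerAlgEquivOfSurjective D.toAlgHom_surjective).symm.trans
      (Ideal.quotientEquivAlgOfEq K ?_)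
    ext z
    rw [TwoSidedIdeal.mem_asIdeal, hI, RingHom.mem_ker]

end SerialGenerators

/-! ### Assembly of the two equivalences. -/

theorem IsMonomialAlgebra.isElementaryAlgebra_and_isNakayamaAlgebra {K A : Type*} [Field K] [Ring A]
    [Algebra K A] [FiniteDimensional K A] (h : IsMonomialAlgebra K A) (hF : IsFrobeniusAlgebra K A) :
    IsElementaryAlgebra K A ∧ IsNakayamaAlgebra A := by
  obtain ⟨V, _, ι, ⟨B⟩⟩ := h.nonempty_pathBasis
  have : Finite ι := Module.Finite.finite_basis B.b
  obtain ⟨f, hf, hf'⟩ := hF.exists_functional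
  exact ⟨B.isElementaryAlgebra, B.isNakayamaAlgebra hf hf'⟩

theorem IsElementaryAlgebra.isMonomialAlgebra {K A : Type*} [Field K] [Ring A] [Algebra K A]
    [FiniteDimensional K A] (h : IsElementaryAlgebra K A) (hN : IsNakayamaAlgebra A) :
    IsMonomialAlgebra K A := by
  obtain ⟨n, _, ⟨D⟩⟩ := h.exists_serialGenerators hN
  exact D.isMonomialAlgebra

theorem IsMonomialAlgebra.isFrobeniusAlgebra {K H : Type*} [Field K] [Ring H] [HopfAlgebra K H]
    [FiniteDimensional K H] (h : IsMonomialAlgebra K H) : IsFrobeniusAlgebra K H := by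
  obtain ⟨V, _, ι, ⟨B⟩⟩ := h.nonempty_pathBasis
  obtain ⟨l, hl0, hl⟩ := B.exists_isLeftIntegral
  exact hl.isFrobeniusAlgebra hl0

theorem corollary2p4 (K : Type v) [Field K] [CharZero K]
    (hK : ∀ n : ℕ, 0 < n → ∃ ζ : K, IsPrimitiveRoot ζ n) :
    (∀ (A : Type u) [Ring A] [Algebra K A] [FiniteDimensional K A],
      (IsMonomialAlgebra K A ∧ IsFrobeniusAlgebra K A) ↔
        (IsElementaryAlgebra K A ∧ IsNakayamaAlgebra A ∧ IsFrobeniusAlgebra K A)) ∧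
    (∀ (H : Type w) [Ring H] [HopfAlgebra K H] [FiniteDimensional K H],
      IsMonomialAlgebra K H ↔ (IsElementaryAlgebra K H ∧ IsNakayamaAlgebra H)) := by
  refine ⟨fun A _ _ _ => ⟨fun ⟨hM, hF⟩ => ?_, fun ⟨hE, hN, hF⟩ => ⟨hE.isMonomialAlgebra hN, hF⟩⟩,
    fun H _ _ _ => ⟨fun hM => ?_, fun ⟨hE, hN⟩ => hE.isMonomialAlgebra hN⟩⟩
  · obtain ⟨hE, hN⟩ := hM.isElementaryAlgebra_and_isNakayamaAlgebra hF
    exact ⟨hE, hN, hF⟩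
  · exact hM.isElementaryAlgebra_and_isNakayamaAlgebra hM.isFrobeniusAlgebra
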